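/- Let $k\ge 1$ be an integer, let $\rho>0$, and let $B=B^{k+1}_\rho=\{x\in\mathbb{R}^{k+1}:|x|<\rho\}$ with the metric $\left(\frac{2\rho^2}{\rho^2-|x|^2}\right)^2|dx|^2$ be the ball model of the $(k+1)$-dimensional hyperbolic space of constant sectional curvature $-1/\rho^2$. Let $\triangle$ be its Laplace--Beltrami operator and let $r(x)=\rho\ln\frac{\rho+|x|}{\rho-|x|}$ be the hyperbolic distance from the origin to $x$. Let $\lambda\in\mathbb{R}$. All functions are real-valued. (1) There is exactly one function $\varphi_\lambda:[0,\infty)\to\mathbb{R}$ such that $\varphi_\lambda(0)=1$ and $x\mapsto\varphi_\lambda(r(x))$ is a $C^2$ function on $B$ satisfying $\triangle f+\lambda f=0$ on $B$ (the radial eigenfunction with value $1$ at the origin), and $$\lim_{r\to\infty}\varphi_\lambda(r)=\begin{cases}+\infty,&\lambda<0,\\ 1,&\lambda=0,\\ 0,&\lambda>0.\end{cases}$$ (2) The Dirichlet eigenvalue problem at infinity, that is, the problem of finding a (not necessarily radial) function $f\in C^2(B)$ with $$\triangle f+\lambda f=0\ \text{ on } B,\qquad f(0)=1,\qquad f(x)\to0\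 \text{ as } r(x)\to\infty$$ (the limit being uniform in the direction of $x$), has a solution if and only if $\lambda>0$. -/

import Mathlib

open Filter Topology

namespace HypBall

/-- The Laplace–Beltrami operator of a Riemannian metric `g` given in one global chart by its
matrix `(g i j)`:
`Δ f = (det g)^(-1/2) ∑ i, ∂_i ((det g)^(1/2) ∑ j, g^{ij} ∂_j f)`. -/
noncomputable def laplaceBeltrami {n : ℕ}
    (g : EuclideanSpace ℝ (Fin n) → Matrix (Fin n) (Fin n) ℝ)
    (f : EuclideanSpace ℝ (Fin n) → ℝ) (x : EuclideanSpace ℝ (Fin n)) : ℝ :=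
  (Real.sqrt (g x).det)⁻¹ *
    ∑ i, fderiv ℝ (fun y => Real.sqrt (g y).det *
      ∑ j, (g y)⁻¹ i j * fderiv ℝ f y (EuclideanSpace.single j 1)) x
        (EuclideanSpace.single i 1)

/-- The metric `(2ρ² / (ρ² - |x|²))² |dx|²` of the ball model of hyperbolic `n`-space with
constant sectional curvature `-1/ρ²`. The model is the open Euclidean ball `|x| < ρ`. -/
noncomputable def ballMetric (n : ℕ) (ρ : ℝ) (x : EuclideanSpace ℝ (Fin n)) :
    Matrix (Fin n) (Fin n) ℝ :=
  (2 * ρ ^ 2 / (ρ ^ 2 - ‖x‖ ^ 2)) ^ 2 • (1 : Matrix (Fin n) (Fin n) ℝ)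

/-- The hyperbolic distance from the origin to a point `x` of the ball model (`|x| < ρ`). -/
noncomputable def hypRadius {n : ℕ} (ρ : ℝ) (x : EuclideanSpace ℝ (Fin n)) : ℝ :=
  ρ * Real.log ((ρ + ‖x‖) / (ρ - ‖x‖))

/-- `f` is a `C²` solution of `Δ f + μ f = 0` on the whole ball model, where `Δ` is the
hyperbolic Laplacian. -/
def SolvesEigenEquation (n : ℕ) (ρ μ : ℝ) (f : EuclideanSpace ℝ (Fin n) → ℝ) : Prop :=
  ContDiffOn ℝ 2 f (Metric.ball 0 ρ) ∧
    ∀ x ∈ Metric.ball (0 : EuclideanSpace ℝ (Fin n)) ρ,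
      laplaceBeltrami (ballMetric n ρ) f x + μ * f x = 0

/-- `φ`, as a function of the hyperbolic distance `r ≥ 0` to the origin, is a radial eigenfunction
of the hyperbolic Laplacian with eigenvalue `μ` and takes the value `1` at the origin. -/
def IsNormalizedRadialEigenfunction (n : ℕ) (ρ μ : ℝ) (φ : ℝ → ℝ) : Prop :=
  SolvesEigenEquation n ρ μ (fun x => φ (hypRadius ρ x)) ∧ φ 0 = 1

/-- `f` solves the Dirichlet eigenvalue problem at infinity with value `1` at the origin:
`Δ f + μ f = 0` on hyperbolic space, `f = 1` at the origin, and `f x → 0` as the hyperbolic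
distance from `x` to the origin tends to infinity. -/
def SolvesDirichletAtInfinity (n : ℕ) (ρ μ : ℝ) (f : EuclideanSpace ℝ (Fin n) → ℝ) : Prop :=
  SolvesEigenEquation n ρ μ f ∧ f 0 = 1 ∧
    Tendsto f (comap (hypRadius ρ) atTop ⊓ 𝓟 (Metric.ball 0 ρ)) (𝓝 0)

end HypBall

namespace HypBall

/-! Put n = k + 1 = m + 2, t = |x|²/ρ², ν = n/2 and Λ = μρ². With p = (1 - t)h', the function
h(|x|²/ρ²) is an eigenfunction away from the origin exactly when (1 - t)h' = p and t(1 - t)p' = -νp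
- (ν - 1)tp - Λh.

Existence: the system has a power series solution at the singular point t = 0, with polynomially
bounded coefficients. It therefore converges for |t| < 1, and h is a C² function of t across the
origin.

Limits as t → 1: for Λ = 0 the series is constant. For Λ > 0 the energy tp² + Λh² is dissipated
through p alone. A small multiple of the cross term thp makes the loss control h as well, and forces
decay like a power of 1 - t (`radialProfile_tendsto_zero`). For Λ < 0 the momentum p never falls to
half its initial value, so h grows at least like -log(1 - t) (`radialProfile_tendsto_atTop`).

Uniqueness: for the difference of two radial solutions an energy tends to 0 at t = 0 and satisfies a
Grönwall inequality, so it vanishes (`IsNormalizedRadialEigenfunction.eqOn`).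

Dirichlet problem: for μ > 0 the radial eigenfunction is a solution. For μ ≤ 0 a solution would have
a positive interior maximum after a small perturbation, against the maximum principle
(`not_solvesDirichletAtInfinity_of_nonpos`). This applies to nonradial f directly, without
averaging. -/

/-! ### Power series with polynomially bounded coefficients -/

theorem _root_.HasSum.of_eq {f g : ℕ → ℝ} {a : ℝ} (hg : HasSum g a) (h : ∀ m, f m = g m) :
    HasSum f a := funext h ▸ hg

/-- Polynomial growth of a real sequence. -/
def PolyGrowth (a : ℕ → ℝ) : Prop := ∃ (K : ℝ) (N : ℕ), ∀ m : ℕ, |a m| ≤ K * ((m : ℝ) + 1) ^ N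

/-- The sum of the power series with coefficients `a`. -/
noncomputable def powSum (a : ℕ → ℝ) (t : ℝ) : ℝ := ∑' m, a m * t ^ m

/-- The coefficients of the termwise derivative. -/
def derivCoeff (a : ℕ → ℝ) (m : ℕ) : ℝ := ((m : ℝ) + 1) * a (m + 1)

theorem PolyGrowth.derivCoeff {a : ℕ → ℝ} (ha : PolyGrowth a) : PolyGrowth (derivCoeff a) := by
  obtain ⟨K, N, h⟩ := ha
  have hK : 0 ≤ K := by simpa using (abs_nonneg _).trans (h 0)
  refine ⟨K * 2 ^ N, N + 1, fun m => ?_⟩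
  have hm : (0 : ℝ) ≤ m := m.cast_nonneg
  have h1 := h (m + 1)
  push_cast at h1
  have h2 : ((m : ℝ) + 1 + 1) ^ N ≤ (2 * ((m : ℝ) + 1)) ^ N := by gcongr; linarith
  rw [mul_pow] at h2
  rw [HypBall.derivCoeff, abs_mul, abs_of_nonneg (by positivity : (0 : ℝ) ≤ (m : ℝ) + 1)]
  calc ((m : ℝ) + 1) * |a (m + 1)| ≤ ((m : ℝ) + 1) * (K * (2 ^ N * ((m : ℝ) + 1) ^ N)) := by
        gcongr; exact h1.trans (by gcongr)
    _ = _ := by ring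

theorem summable_add_one_pow_mul_geometric (N : ℕ) {r : ℝ} (h0 : 0 ≤ r) (hr : r < 1) :
    Summable fun m : ℕ => ((m : ℝ) + 1) ^ N * r ^ m := by
  have hn : ‖r‖ < 1 := by rwa [Real.norm_eq_abs, abs_of_nonneg h0]
  have s1 : Summable fun m : ℕ => (2 : ℝ) ^ N * ((m : ℝ) ^ N * r ^ m) :=
    (summable_pow_mul_geometric_of_norm_lt_one N hn).mul_left _
  have s2 : Summable fun m : ℕ => (2 : ℝ) ^ N * r ^ m :=
    (summable_geometric_of_lt_one h0 hr).mul_left _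
  have h := s1.add s2
  refine h.of_nonneg_of_le (fun m => by positivity) fun m => ?_
  have : ((m : ℝ) + 1) ^ N ≤ 2 ^ N * (m : ℝ) ^ N + 2 ^ N := by
    rcases Nat.eq_zero_or_pos m with rfl | hm
    · simp only [Nat.cast_zero, zero_add, one_pow]
      have : (1 : ℝ) ≤ 2 ^ N := one_le_pow₀ (by norm_num)
      exact this.trans (le_add_of_nonneg_left (by positivity))
    · have h1 : (1 : ℝ) ≤ m := by exact_mod_cast hm
      have : ((m : ℝ) + 1) ^ N ≤ (2 * m) ^ N := by gcongr; linarith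
      rw [mul_pow] at this
      have : (0 : ℝ) ≤ 2 ^ N := by positivity
      linarith
  calc ((m : ℝ) + 1) ^ N * r ^ m ≤ (2 ^ N * (m : ℝ) ^ N + 2 ^ N) * r ^ m := by gcongr
    _ = _ := by ring

theorem PolyGrowth.hasSum {a : ℕ → ℝ} (ha : PolyGrowth a) {t : ℝ} (ht : |t| < 1) :
    HasSum (fun m => a m * t ^ m) (powSum a t) := by
  obtain ⟨K, N, h⟩ := ha
  refine Summable.hasSum (Summable.of_norm_bounded
    ((summable_add_one_pow_mul_geometric N (abs_nonneg t) ht).mul_left K) fun m => ?_)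
  rw [Real.norm_eq_abs, abs_mul, abs_pow, ← mul_assoc]
  gcongr
  exact h m

theorem PolyGrowth.hasDerivAt {a : ℕ → ℝ} (ha : PolyGrowth a) {t : ℝ} (ht : |t| < 1) :
    HasDerivAt (powSum a) (powSum (HypBall.derivCoeff a) t) t := by
  obtain ⟨r, hr1, hr2⟩ := exists_between ht
  have hr0 : 0 ≤ r := (abs_nonneg t).trans hr1.le
  obtain ⟨K, N, h⟩ := ha.derivCoeff
  have hs : Summable fun m : ℕ => a m * t ^ m := (ha.hasSum ht).summable
  have hu : Summable fun m : ℕ => K * (((m : ℝ) + 1) ^ N * r ^ m) :=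
    (summable_add_one_pow_mul_geometric N hr0 hr2).mul_left K
  -- The constant term is left out, so that the termwise derivatives are exactly the terms with
  -- coefficients `derivCoeff a`; it returns through `tsum_eq_zero_add`.
  have hd := hasDerivAt_tsum_of_isPreconnected (g := fun (m : ℕ) (y : ℝ) => a (m + 1) * y ^ (m + 1))
    (g' := fun m y => HypBall.derivCoeff a m * y ^ m) (t := Metric.ball 0 r) (y₀ := t) (y := t) hu
    Metric.isOpen_ball (convex_ball _ _).isPreconnected
    (fun m y _ => by
      have := (hasDerivAt_pow (m + 1) y).const_mul (a (m + 1))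
      refine this.congr_deriv ?_
      simp [HypBall.derivCoeff]; ring)
    (fun m y hy => by
      have hy' : |y| ≤ r := by simpa using (Metric.mem_ball.1 hy).le
      rw [Real.norm_eq_abs, abs_mul, abs_pow, ← mul_assoc]
      have := h m
      have h0 := (abs_nonneg _).trans this
      gcongr) (by simpa using hr1) ((summable_nat_add_iff 1).2 hs) (by simpa using hr1)
  refine (hd.const_add (a 0)).congr_of_eventuallyEq ?_
  filter_upwards [(isOpen_lt continuous_abs continuous_const).mem_nhds ht] with y hy
  have := (ha.hasSum hy).summable.tsum_eq_zero_add
  simpa [powSum] using this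

theorem PolyGrowth.hasSum_natCast_mul {a : ℕ → ℝ} (ha : PolyGrowth a) {t : ℝ} (ht : |t| < 1) :
    HasSum (fun m : ℕ => (m : ℝ) * a m * t ^ m) (t * powSum (HypBall.derivCoeff a) t) := by
  rw [← hasSum_nat_add_iff' 1]
  simp only [Finset.range_one, Finset.sum_singleton, Nat.cast_zero, zero_mul, sub_zero]
  refine ((ha.derivCoeff.hasSum ht).mul_left t).of_eq fun m => ?_
  rw [HypBall.derivCoeff]; push_cast; ring

theorem PolyGrowth.hasSum_succ {a : ℕ → ℝ} (ha : PolyGrowth a) {t : ℝ} (ht : |t| < 1) :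
    HasSum (fun m : ℕ => a (m + 1) * t ^ (m + 1)) (powSum a t - a 0) := by
  simpa using (hasSum_nat_add_iff' 1).2 (ha.hasSum ht)

theorem powSum_zero (a : ℕ → ℝ) : powSum a 0 = a 0 := by
  rw [powSum, tsum_eq_single 0 (fun m hm => by simp [hm])]; simp

/-! ### Series solution of the radial system -/

/-- Coefficients `(a m, b m)` of the regular solution `(h, p)` of the radial eigenvalue system
`(1 - t) h' = p`, `t (1 - t) p' = -ν p - (ν - 1) t p - Λ h`. -/
noncomputable def radialCoeff (ν Λ : ℝ) : ℕ → ℝ × ℝ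
  | 0 => (1, -Λ / ν)
  | m + 1 =>
    let x := (m * (radialCoeff ν Λ m).1 + (radialCoeff ν Λ m).2) / (m + 1)
    (x, ((m + 1 - ν) * (radialCoeff ν Λ m).2 - Λ * x) / (m + 1 + ν))

theorem radialCoeff_fst_succ (ν Λ : ℝ) (m : ℕ) :
    ((m : ℝ) + 1) * (radialCoeff ν Λ (m + 1)).1 =
      m * (radialCoeff ν Λ m).1 + (radialCoeff ν Λ m).2 := by
  have : (m : ℝ) + 1 ≠ 0 := by positivity
  rw [radialCoeff]; field_simp

theorem radialCoeff_snd_succ {ν : ℝ} (hν : 1 ≤ ν) (Λ : ℝ) (m : ℕ) :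
    ((m : ℝ) + 1 + ν) * (radialCoeff ν Λ (m + 1)).2 =
      (m + 1 - ν) * (radialCoeff ν Λ m).2 - Λ * (radialCoeff ν Λ (m + 1)).1 := by
  have h0 : 0 < ν := by linarith
  have : (m : ℝ) + 1 + ν ≠ 0 := by positivity
  rw [radialCoeff]; field_simp

/-- One recursion step multiplies |a| + |b| by at most 1 + N/(m + 1) ≤ ((m + 2)/(m + 1))^N, and the
product of these factors telescopes. -/
theorem radialCoeff_growth {ν : ℝ} (hν : 1 ≤ ν) (Λ : ℝ) :
    ∃ (K : ℝ) (N : ℕ), ∀ m : ℕ, |(radialCoeff ν Λ m).1| + |(radialCoeff ν Λ m).2| ≤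
      K * ((m : ℝ) + 1) ^ N := by
  have h0 : 0 < ν := by linarith
  obtain ⟨N, hN⟩ := exists_nat_ge (2 * |Λ| + 1)
  refine ⟨|(radialCoeff ν Λ 0).1| + |(radialCoeff ν Λ 0).2|, N, fun m => ?_⟩
  induction m with
  | zero => simp
  | succ m ih =>
    set a := (radialCoeff ν Λ m).1
    set b := (radialCoeff ν Λ m).2
    set a' := (radialCoeff ν Λ (m + 1)).1 with ha'
    set b' := (radialCoeff ν Λ (m + 1)).2
    set S := |(radialCoeff ν Λ 0).1| + |(radialCoeff ν Λ 0).2|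
    have hm : (0 : ℝ) ≤ m := m.cast_nonneg
    have hm1 : (0 : ℝ) < (m : ℝ) + 1 := by positivity
    have e1 : ((m : ℝ) + 1) * a' = m * a + b := radialCoeff_fst_succ ν Λ m
    have e2 : ((m : ℝ) + 1 + ν) * b' = (m + 1 - ν) * b - Λ * a' := radialCoeff_snd_succ hν Λ m
    have h1 : ((m : ℝ) + 1) * |a'| ≤ m * |a| + |b| := by
      nth_rewrite 1 [← abs_of_pos hm1]
      rw [← abs_mul, e1]
      refine (abs_add_le _ _).trans (by rw [abs_mul, abs_of_nonneg hm])
    have h2 : ((m : ℝ) + 1 + ν) * |b'| ≤ (m + 1 + ν) * |b| + |Λ| * |a'| := by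
      have : (0 : ℝ) < (m : ℝ) + 1 + ν := by positivity
      nth_rewrite 1 [← abs_of_pos this]
      rw [← abs_mul, e2]
      refine (abs_sub _ _).trans ?_
      rw [abs_mul, abs_mul]
      gcongr
      rw [abs_le]; constructor <;> linarith
    have h3 : |b'| ≤ |b| + |Λ| * |a'| / (m + 1) := by
      have : |b'| ≤ |b| + |Λ| * |a'| / (m + 1 + ν) := by
        rw [← sub_le_iff_le_add', le_div_iff₀ (by positivity)]; linarith
      refine this.trans ?_
      gcongr
      linarith
    have h4 : |a'| ≤ |a| + |b| / (m + 1) := by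
      rw [← sub_le_iff_le_add', le_div_iff₀ hm1]; nlinarith [abs_nonneg a]
    have h5 : |a'| ≤ 1 * (|a| + |b|) := by
      have : |b| / ((m : ℝ) + 1) ≤ |b| := div_le_self (abs_nonneg _) (by linarith)
      linarith
    have h6 : |a'| + |b'| ≤ (|a| + |b|) * (1 + N * (1 / (m + 1))) := by
      have h7 : |Λ| * |a'| / ((m : ℝ) + 1) ≤ |Λ| * (1 * (|a| + |b|)) / (m + 1) := by gcongr
      have h8 : |b| / ((m : ℝ) + 1) ≤ (|a| + |b|) / (m + 1) := by
        gcongr; linarith [abs_nonneg a]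
      have h9 : (2 * |Λ| + 1) * ((|a| + |b|) / ((m : ℝ) + 1)) ≤ N * ((|a| + |b|) / (m + 1)) := by
        gcongr
      have h10 : 0 ≤ |Λ| * ((|a| + |b|) / ((m : ℝ) + 1)) := by positivity
      have e3 : |Λ| * (1 * (|a| + |b|)) / ((m : ℝ) + 1) = |Λ| * ((|a| + |b|) / (m + 1)) := by ring
      have e4 : (|a| + |b|) * (1 + N * (1 / ((m : ℝ) + 1))) =
        |a| + |b| + N * ((|a| + |b|) / (m + 1)) := by ring
      rw [e4]
      linarith
    have h7 : 1 + (N : ℝ) * (1 / (m + 1)) ≤ (1 + 1 / (m + 1)) ^ N :=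
      one_add_mul_le_pow (by have : 0 ≤ 1 / ((m : ℝ) + 1) := by positivity
                             linarith) N
    calc |a'| + |b'| ≤ (|a| + |b|) * (1 + N * (1 / (m + 1))) := h6
      _ ≤ (S * ((m : ℝ) + 1) ^ N) * (1 + 1 / (m + 1)) ^ N := by gcongr
      _ = S * ((((m + 1 : ℕ) : ℝ)) + 1) ^ N := by
        rw [mul_assoc, ← mul_pow]; congr 2; push_cast; field_simp

theorem polyGrowth_radialCoeff_fst {ν : ℝ} (hν : 1 ≤ ν) (Λ : ℝ) :
    PolyGrowth fun m => (radialCoeff ν Λ m).1 :=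
  let ⟨K, N, h⟩ := radialCoeff_growth hν Λ
  ⟨K, N, fun m => (le_add_of_nonneg_right (abs_nonneg _)).trans (h m)⟩

theorem polyGrowth_radialCoeff_snd {ν : ℝ} (hν : 1 ≤ ν) (Λ : ℝ) :
    PolyGrowth fun m => (radialCoeff ν Λ m).2 :=
  let ⟨K, N, h⟩ := radialCoeff_growth hν Λ
  ⟨K, N, fun m => (le_add_of_nonneg_left (abs_nonneg _)).trans (h m)⟩

/-- The radial eigenfunction as a function of `t = |x|² / ρ²`. -/
noncomputable def radialProfile (ν Λ : ℝ) : ℝ → ℝ := powSum fun m => (radialCoeff ν Λ m).1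

/-- `(1 - t)` times the derivative of the radial profile. -/
noncomputable def radialMomentum (ν Λ : ℝ) : ℝ → ℝ := powSum fun m => (radialCoeff ν Λ m).2

theorem hasDerivAt_radialProfile {ν : ℝ} (hν : 1 ≤ ν) (Λ : ℝ) {t : ℝ} (ht : |t| < 1) :
    HasDerivAt (radialProfile ν Λ) (radialMomentum ν Λ t / (1 - t)) t := by
  have ha := polyGrowth_radialCoeff_fst hν Λ
  have hd := ha.hasDerivAt ht
  refine hd.congr_deriv ?_
  have h1 : 0 < 1 - t := by linarith [(abs_lt.1 ht).2]
  rw [eq_div_iff h1.ne']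
  set D := powSum (derivCoeff fun m => (radialCoeff ν Λ m).1) t
  have s1 : HasSum (fun m => (radialCoeff ν Λ m).2 * t ^ m) (radialMomentum ν Λ t) :=
    (polyGrowth_radialCoeff_snd hν Λ).hasSum ht
  have s2 : HasSum (fun m : ℕ => ((m : ℝ) + 1) * (radialCoeff ν Λ (m + 1)).1 * t ^ m) D :=
    ha.derivCoeff.hasSum ht
  have s4 := s2.sub (ha.hasSum_natCast_mul ht)
  have e : D - t * D = radialMomentum ν Λ t := by
    refine s4.unique (s1.of_eq fun m => ?_)
    have := radialCoeff_fst_succ ν Λ m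
    linear_combination t ^ m * this
  linear_combination e

/-- The factor t(1 - t) is not divided out, so that the equation also makes sense at the singular
point t = 0. -/
theorem hasDerivAt_radialMomentum {ν : ℝ} (hν : 1 ≤ ν) (Λ : ℝ) {t : ℝ} (ht : |t| < 1) :
    ∃ p' : ℝ, HasDerivAt (radialMomentum ν Λ) p' t ∧
      t * (1 - t) * p' = -ν * radialMomentum ν Λ t - (ν - 1) * t * radialMomentum ν Λ t
        - Λ * radialProfile ν Λ t := by
  have ha := polyGrowth_radialCoeff_fst hν Λ
  have hb := polyGrowth_radialCoeff_snd hν Λ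
  refine ⟨_, hb.hasDerivAt ht, ?_⟩
  set D := powSum (derivCoeff fun m => (radialCoeff ν Λ m).2) t
  have s1 : HasSum (fun m : ℕ => ((m : ℝ) + 1) * (radialCoeff ν Λ (m + 1)).2 * t ^ m) D :=
    hb.derivCoeff.hasSum ht
  have s2 := (hb.hasSum_natCast_mul ht).mul_left t
  have s3 := hb.hasSum_succ ht
  have s4 := (hb.hasSum ht).mul_left t
  have s5 := ha.hasSum_succ ht
  have s6 := (s1.mul_left t).sub s2
  have s7 := ((s3.mul_left (-ν)).sub (s4.mul_left (ν - 1))).sub (s5.mul_left Λ)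
  have e := s6.unique (s7.of_eq fun m => by
    have := radialCoeff_snd_succ hν Λ m
    linear_combination t ^ (m + 1) * this)
  -- The series identity above covers only powers t^(m + 1). This is the coefficient of t^0, which
  -- dictates the initial value -Λ/ν of p.
  have e0 : ν * (radialCoeff ν Λ 0).2 = -Λ := by
    have : ν ≠ 0 := by positivity
    rw [radialCoeff]; field_simp
  have e1 : (radialCoeff ν Λ 0).1 = 1 := by rw [radialCoeff]
  rw [e1] at e
  rw [radialMomentum, radialProfile]
  linear_combination e + e0

theorem radialProfile_zero (ν Λ : ℝ) : radialProfile ν Λ 0 = 1 := by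
  rw [radialProfile, powSum_zero, radialCoeff]

theorem radialMomentum_zero (ν Λ : ℝ) : radialMomentum ν Λ 0 = -Λ / ν := by
  rw [radialMomentum, powSum_zero, radialCoeff]

theorem contDiffOn_radialProfile {ν : ℝ} (hν : 1 ≤ ν) (Λ : ℝ) :
    ContDiffOn ℝ 2 (radialProfile ν Λ) {t | |t| < 1} := by
  have ho : IsOpen {t : ℝ | |t| < 1} := isOpen_lt continuous_abs continuous_const
  have key : ∀ (f g : ℝ → ℝ) (n : ℕ), (∀ t, |t| < 1 → HasDerivAt f (g t) t) →
      ContDiffOn ℝ n g {t | |t| < 1} → ContDiffOn ℝ (n + 1) f {t | |t| < 1} := by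
    intro f g n hfg hg
    rw [contDiffOn_succ_iff_deriv_of_isOpen ho]
    refine ⟨fun t ht => (hfg t ht).differentiableAt.differentiableWithinAt, by simp, ?_⟩
    exact hg.congr fun t ht => (hfg t ht).deriv
  have ha := polyGrowth_radialCoeff_fst hν Λ
  have h0 : ContDiffOn ℝ (0 : ℕ) (powSum (derivCoeff (derivCoeff fun m => (radialCoeff ν Λ m).1)))
      {t | |t| < 1} := by
    simp only [Nat.cast_zero, contDiffOn_zero]
    exact fun t ht => (ha.derivCoeff.derivCoeff.hasDerivAt ht).continuousAt.continuousWithinAt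
  have h1 := key _ _ 0 (fun t ht => ha.derivCoeff.hasDerivAt ht) h0
  have h2 := key _ _ 1 (fun t ht => ha.hasDerivAt ht) (by simpa using h1)
  exact h2.of_le (by norm_num)

theorem radialProfile_eq_one {ν : ℝ} (hν : 1 ≤ ν) (t : ℝ) : radialProfile ν 0 t = 1 := by
  have h : ∀ m, (radialCoeff ν 0 m).2 = 0 ∧ (radialCoeff ν 0 (m + 1)).1 = 0 := by
    intro m
    induction m with
    | zero => simp [radialCoeff]
    | succ m ih =>
      have e1 := radialCoeff_snd_succ hν 0 m
      have e2 := radialCoeff_fst_succ ν 0 (m + 1)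
      have h1 : (m : ℝ) + 1 + ν ≠ 0 := by positivity
      have h2 : ((m + 1 : ℕ) : ℝ) + 1 ≠ 0 := by positivity
      have h3 : (radialCoeff ν 0 (m + 1)).2 = 0 := by simpa [ih.1, h1] using e1
      exact ⟨h3, by simpa only [ih.2, h3, mul_zero, add_zero, mul_eq_zero, h2, false_or] using e2⟩
  rw [radialProfile, powSum, tsum_eq_single 0]
  · simp [radialCoeff]
  · intro m hm
    obtain ⟨j, rfl⟩ := Nat.exists_eq_succ_of_ne_zero hm
    simp [(h j).2]

/-! ### Behaviour of the radial profile as t → 1 -/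

/-- Grönwall's inequality in the variable -log(1 - t). Only a limit of E at 0 is needed, and c may
have either sign: c < 0 gives decay, c > 0 gives uniqueness. -/
theorem mul_rpow_le_of_deriv_le {E E' : ℝ → ℝ} {c E0 : ℝ}
    (hE : ∀ t ∈ Set.Ioo (0 : ℝ) 1, HasDerivAt E (E' t) t)
    (hle : ∀ t ∈ Set.Ioo (0 : ℝ) 1, (1 - t) * E' t ≤ c * E t)
    (h0 : Tendsto E (𝓝[>] 0) (𝓝 E0)) {t : ℝ} (ht : t ∈ Set.Ioo (0 : ℝ) 1) :
    E t * (1 - t) ^ c ≤ E0 := by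
  have hd : ∀ s ∈ Set.Ioo (0 : ℝ) 1, HasDerivAt (fun s => E s * (1 - s) ^ c)
      (E' s * (1 - s) ^ c + E s * (-1 * c * (1 - s) ^ (c - 1))) s := by
    intro s hs
    have h1 : HasDerivAt (fun s : ℝ => 1 - s) (-1) s := by
      simpa using (hasDerivAt_id s).const_sub 1
    exact (hE s hs).mul (h1.rpow_const (Or.inl (by linarith [hs.2])))
  have hanti : AntitoneOn (fun s => E s * (1 - s) ^ c) (Set.Ioo (0 : ℝ) 1) := by
    refine antitoneOn_of_deriv_nonpos (convex_Ioo _ _)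
      (fun s hs => (hd s hs).continuousAt.continuousWithinAt) ?_ ?_
    · rw [interior_Ioo]
      exact fun s hs => (hd s hs).differentiableAt.differentiableWithinAt
    · rw [interior_Ioo]
      intro s hs
      have hpos : 0 < 1 - s := by linarith [hs.2]
      have e : (1 - s) ^ c = (1 - s) * (1 - s) ^ (c - 1) := by
        rw [Real.rpow_sub_one hpos.ne']; field_simp
      rw [(hd s hs).deriv, e]
      have := mul_le_mul_of_nonneg_right (hle s hs) (Real.rpow_nonneg hpos.le (c - 1))
      linarith
  have hlim : Tendsto (fun s => E s * (1 - s) ^ c) (𝓝[>] 0) (𝓝 E0) := by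
    have h1 : ContinuousAt (fun s : ℝ => (1 - s) ^ c) 0 :=
      (continuousAt_const.sub continuousAt_id).rpow_const (Or.inl (by norm_num))
    have h2 : Tendsto (fun s : ℝ => (1 - s) ^ c) (𝓝[>] 0) (𝓝 1) := by
      simpa using h1.tendsto.mono_left nhdsWithin_le_nhds
    simpa using h0.mul h2
  refine ge_of_tendsto hlim ?_
  filter_upwards [Ioo_mem_nhdsGT ht.1] with s hs
  exact hanti ⟨hs.1, hs.2.trans ht.2⟩ ht hs.2.le

theorem radialProfile_tendsto_zero {ν Λ : ℝ} (hν : 1 ≤ ν) (hΛ : 0 < Λ) :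
    Tendsto (radialProfile ν Λ) (𝓝[<] 1) (𝓝 0) := by
  set h := radialProfile ν Λ
  set p := radialMomentum ν Λ
  -- The bounds 1/2 and Λ/2 keep tp² + Λh² + 2εthp comparable with tp² + Λh². The last bound lets
  -- the dissipation of p² absorb the error terms produced by the cross term.
  obtain ⟨ε, hε, hε1, hε2, hε3⟩ : ∃ ε : ℝ, 0 < ε ∧ ε ≤ 1 / 2 ∧ ε ≤ Λ / 2 ∧
      ε * (2 * Λ + 4 * ν ^ 2) ≤ Λ / 2 := by
    have hD : 0 < 2 * Λ + 4 * ν ^ 2 := by positivity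
    refine ⟨min (min (1 / 2) (Λ / 2)) (Λ / 2 / (2 * Λ + 4 * ν ^ 2)), ?_, ?_, ?_, ?_⟩
    · exact lt_min (lt_min (by norm_num) (by positivity)) (by positivity)
    · exact (min_le_left _ _).trans (min_le_left _ _)
    · exact (min_le_left _ _).trans (min_le_right _ _)
    · exact (le_div_iff₀ hD).1 (min_le_right _ _)
  have habs : ∀ t ∈ Set.Ioo (0 : ℝ) 1, |t| < 1 := fun t ht => abs_lt.2 ⟨by linarith [ht.1], ht.2⟩
  choose! p' hp' hp'eq using fun t (ht : t ∈ Set.Ioo (0 : ℝ) 1) =>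
    hasDerivAt_radialMomentum hν Λ (habs t ht)
  have hh := fun t (ht : t ∈ Set.Ioo (0 : ℝ) 1) => hasDerivAt_radialProfile hν Λ (habs t ht)
  have hL : ∀ t ∈ Set.Ioo (0 : ℝ) 1,
      HasDerivAt (fun t => t * p t ^ 2 + Λ * h t ^ 2 + 2 * ε * (t * h t * p t))
      (p t ^ 2 + 2 * t * p t * p' t + 2 * Λ * h t * (p t / (1 - t)) +
        2 * ε * (h t * p t + t * (p t / (1 - t)) * p t + t * h t * p' t)) t := by
    intro t ht
    refine ((((hasDerivAt_id t).mul ((hp' t ht).pow 2)).add (((hh t ht).pow 2).const_mul Λ)).add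
      ((((hasDerivAt_id t).mul (hh t ht)).mul (hp' t ht)).const_mul (2 * ε))).congr_deriv ?_
    simp only [id_eq, Pi.mul_apply, Pi.pow_apply]
    simp only [← show h = radialProfile ν Λ from rfl, ← show p = radialMomentum ν Λ from rfl]
    push_cast
    ring
  have hbound : ∀ t ∈ Set.Ioo (0 : ℝ) 1, (1 - t) * (p t ^ 2 + 2 * t * p t * p' t +
      2 * Λ * h t * (p t / (1 - t)) + 2 * ε * (h t * p t + t * (p t / (1 - t)) * p t +
        t * h t * p' t)) ≤
      (-(ε / 2)) * (t * p t ^ 2 + Λ * h t ^ 2 + 2 * ε * (t * h t * p t)) := by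
    intro t ht
    have h1 : 0 < 1 - t := by linarith [ht.2]
    have e1 := hp'eq t ht
    have e2 : (1 - t) * (p t / (1 - t)) = p t := by field_simp
    -- Without ε only -(2ν - 1)(1 + t)p² remains, since the hp terms cancel. The cross term supplies
    -- the missing -2εΛh².
    have e : (1 - t) * (p t ^ 2 + 2 * t * p t * p' t +
      2 * Λ * h t * (p t / (1 - t)) + 2 * ε * (h t * p t + t * (p t / (1 - t)) * p t +
        t * h t * p' t)) = -(2 * ν - 1) * (1 + t) * p t ^ 2 +
        2 * ε * (t * p t ^ 2 - Λ * h t ^ 2) + 2 * ε * (h t * p t * ((1 - ν) - ν * t)) := by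
      linear_combination (2 * p t + 2 * ε * h t) * e1 + (2 * Λ * h t + 2 * ε * t * p t) * e2
    rw [e]
    -- Young's inequality with weight Λ: half of the gain -2εΛh² pays for the mixed term, at the
    -- cost of a multiple of p².
    have b1 : 2 * (h t * p t * ((1 - ν) - ν * t)) ≤ Λ * h t ^ 2 + 4 * ν ^ 2 / Λ * p t ^ 2 := by
      have hk : ((1 - ν) - ν * t) ^ 2 ≤ 4 * ν ^ 2 := by
        have k1 : 0 ≤ ν * t := mul_nonneg (by linarith) ht.1.le
        have k2 : ν * t ≤ ν * 1 := by gcongr; exact ht.2.le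
        have := sq_le_sq' (a := (1 - ν) - ν * t) (b := 2 * ν) (by linarith) (by linarith)
        linarith
      have h2 : 0 ≤ (Λ * h t - ((1 - ν) - ν * t) * p t) ^ 2 := sq_nonneg _
      have h3 : ((1 - ν) - ν * t) ^ 2 * p t ^ 2 ≤ 4 * ν ^ 2 * p t ^ 2 := by gcongr
      refine le_of_mul_le_mul_left ?_ hΛ
      have e3 : Λ * (Λ * h t ^ 2 + 4 * ν ^ 2 / Λ * p t ^ 2) =
        Λ ^ 2 * h t ^ 2 + 4 * ν ^ 2 * p t ^ 2 := by field_simp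
      rw [e3]
      linarith
    have b2 : ε * (2 + 4 * ν ^ 2 / Λ) ≤ 1 / 2 := by
      refine le_of_mul_le_mul_left ?_ hΛ
      have : Λ * (ε * (2 + 4 * ν ^ 2 / Λ)) = ε * (2 * Λ + 4 * ν ^ 2) := by field_simp
      linarith
    have b3 : 2 * (t * h t * p t) ≤ h t ^ 2 + p t ^ 2 := by
      nlinarith [sq_nonneg (h t - p t), sq_nonneg (h t + p t), ht.1, ht.2]
    have P := sq_nonneg (p t)
    have H := sq_nonneg (h t)
    have c1 : ε * (2 * (h t * p t * ((1 - ν) - ν * t))) ≤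
        ε * (Λ * h t ^ 2 + 4 * ν ^ 2 / Λ * p t ^ 2) := by gcongr
    have c2 : ε * (2 + 4 * ν ^ 2 / Λ) * p t ^ 2 ≤ 1 / 2 * p t ^ 2 := by gcongr
    have c3 : ε / 2 * (t * p t ^ 2 + Λ * h t ^ 2 + 2 * ε * (t * h t * p t)) ≤
        ε / 2 * (2 * p t ^ 2 + 2 * (Λ * h t ^ 2)) := by
      have d1 : t * p t ^ 2 ≤ 1 * p t ^ 2 := by gcongr; exact ht.2.le
      have d2 : ε * (2 * (t * h t * p t)) ≤ ε * (h t ^ 2 + p t ^ 2) := by gcongr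
      have d3 : ε * h t ^ 2 ≤ Λ / 2 * h t ^ 2 := by gcongr
      have d4 : ε * p t ^ 2 ≤ 1 / 2 * p t ^ 2 := by gcongr
      have d5 : 0 ≤ Λ * h t ^ 2 := by positivity
      exact mul_le_mul_of_nonneg_left (by linarith) (by positivity)
    have c4 : ε * p t ^ 2 ≤ 1 / 2 * p t ^ 2 := by gcongr
    have c5 : 1 * p t ^ 2 ≤ (2 * ν - 1) * (1 + t) * p t ^ 2 := by
      gcongr; nlinarith [ht.1]
    have c6 : ε * (t * p t ^ 2) ≤ ε * (1 * p t ^ 2) := by gcongr; exact ht.2.le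
    linarith
  have hh0 : ContinuousAt h 0 := (hasDerivAt_radialProfile hν Λ (by simp)).continuousAt
  have hp0 : ContinuousAt p 0 := by
    obtain ⟨q, hq, -⟩ := hasDerivAt_radialMomentum hν Λ (t := 0) (by simp)
    exact hq.continuousAt
  have hL0 : Tendsto (fun t => t * p t ^ 2 + Λ * h t ^ 2 + 2 * ε * (t * h t * p t)) (𝓝[>] 0)
      (𝓝 Λ) := by
    have hc : ContinuousAt (fun t => t * p t ^ 2 + Λ * h t ^ 2 + 2 * ε * (t * h t * p t)) 0 := by
      fun_prop
    have e : h 0 = 1 := radialProfile_zero ν Λ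
    simpa [e] using hc.tendsto.mono_left nhdsWithin_le_nhds
  have hmain : ∀ t ∈ Set.Ioo (0 : ℝ) 1, h t ^ 2 ≤ 2 * (1 - t) ^ (ε / 2) := by
    intro t ht
    have h1 : 0 < 1 - t := by linarith [ht.2]
    have k := mul_rpow_le_of_deriv_le hL hbound hL0 ht
    rw [Real.rpow_neg h1.le, ← div_eq_mul_inv, div_le_iff₀ (Real.rpow_pos_of_pos h1 _)] at k
    have b3 : -(h t ^ 2 + t * p t ^ 2) ≤ 2 * (t * h t * p t) := by
      nlinarith [sq_nonneg (h t + p t), ht.1, ht.2,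
        mul_nonneg ht.1.le (sq_nonneg (h t + p t)), mul_nonneg h1.le (sq_nonneg (h t))]
    have d2 : ε * -(h t ^ 2 + t * p t ^ 2) ≤ ε * (2 * (t * h t * p t)) := by gcongr
    have d3 : ε * h t ^ 2 ≤ Λ / 2 * h t ^ 2 := by gcongr
    have d0 : 0 ≤ t * p t ^ 2 := mul_nonneg ht.1.le (sq_nonneg _)
    have d4 : ε * (t * p t ^ 2) ≤ 1 / 2 * (t * p t ^ 2) := by gcongr
    refine le_of_mul_le_mul_left ?_ (half_pos hΛ)
    linarith
  have hz : Tendsto (fun t : ℝ => 2 * (1 - t) ^ (ε / 2)) (𝓝[<] 1) (𝓝 0) := by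
    have hc : Continuous (fun t : ℝ => 2 * (1 - t) ^ (ε / 2)) :=
      continuous_const.mul ((continuous_const.sub continuous_id).rpow_const
        fun _ => Or.inr (by positivity))
    have := (hc.tendsto 1).mono_left (nhdsWithin_le_nhds (s := Set.Iio 1))
    simpa [Real.zero_rpow (by positivity : ε / 2 ≠ 0)] using this
  have hsq : Tendsto (fun t => h t ^ 2) (𝓝[<] 1) (𝓝 0) := by
    refine squeeze_zero' (Eventually.of_forall fun t => sq_nonneg _) ?_ hz
    filter_upwards [Ioo_mem_nhdsLT (zero_lt_one' ℝ)] with t ht using hmain t ht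
  rw [tendsto_zero_iff_abs_tendsto_zero]
  simpa [Real.sqrt_sq_eq_abs, Function.comp_def] using hsq.sqrt

/-- The bound δ is half of p(0) = -Λ/ν. Up to a first time s with p(s) ≤ δ the profile increases, so
h(s) ≥ 1. The equation then gives s(1 - s)p'(s) ≥ 2νδ - (2ν - 1)δ > 0, which is impossible when p
comes down to δ from above. -/
theorem radialMomentum_gt {ν Λ : ℝ} (hν : 1 ≤ ν) (hΛ : Λ < 0) {t : ℝ} (ht0 : 0 ≤ t) (ht1 : t < 1) :
    -Λ / (2 * ν) < radialMomentum ν Λ t := by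
  set δ := -Λ / (2 * ν) with hδ
  have hνpos : 0 < ν := by linarith
  have hδ0 : 0 < δ := div_pos (by linarith) (by linarith)
  have hδΛ : 2 * ν * δ = -Λ := by rw [hδ]; field_simp
  have hp0 : δ < radialMomentum ν Λ 0 := by
    rw [radialMomentum_zero, lt_div_iff₀ hνpos]; linarith [mul_pos hνpos hδ0]
  by_contra! hcon
  have hcont : ContinuousOn (radialMomentum ν Λ) (Set.Icc 0 t) := fun s hs => by
    obtain ⟨q, hq, -⟩ := hasDerivAt_radialMomentum hν Λ (t := s)
      (abs_lt.2 ⟨by linarith [hs.1], hs.2.trans_lt ht1⟩)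
    exact hq.continuousAt.continuousWithinAt
  have hcl : IsCompact {s ∈ Set.Icc 0 t | radialMomentum ν Λ s ≤ δ} :=
    isCompact_Icc.of_isClosed_subset
      (hcont.preimage_isClosed_of_isClosed isClosed_Icc (isClosed_Iic (a := δ)))
      fun s hs => hs.1
  obtain ⟨s, ⟨hs, hsδ⟩, hmin⟩ := hcl.exists_isLeast ⟨t, ⟨ht0, le_rfl⟩, hcon⟩
  have hs0 : 0 < s := by
    rcases hs.1.eq_or_lt with h | h
    · rw [← h] at hsδ; linarith
    · exact h
  have hs1 : s < 1 := hs.2.trans_lt ht1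
  have hbefore : ∀ u, 0 ≤ u → u < s → δ < radialMomentum ν Λ u := by
    intro u hu hus
    by_contra! hle
    exact absurd (hmin ⟨⟨hu, hus.le.trans hs.2⟩, hle⟩) (not_le.2 hus)
  have hder := fun u (hu : u ∈ Set.Icc 0 s) => hasDerivAt_radialProfile hν Λ
    (abs_lt.2 ⟨by linarith [hu.1], hu.2.trans_lt hs1⟩)
  have hmono : MonotoneOn (radialProfile ν Λ) (Set.Icc 0 s) := by
    refine monotoneOn_of_deriv_nonneg (convex_Icc _ _)
      (fun u hu => (hder u hu).continuousAt.continuousWithinAt) ?_ ?_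
    · exact fun u hu => (hder u (interior_subset hu)).differentiableAt.differentiableWithinAt
    · intro u hu
      rw [(hder u (interior_subset hu)).deriv]
      rw [interior_Icc] at hu
      exact div_nonneg (hδ0.trans (hbefore u hu.1.le hu.2)).le (by linarith [hu.2])
  have h1 : 1 ≤ radialProfile ν Λ s := by
    simpa [radialProfile_zero] using hmono ⟨le_rfl, hs0.le⟩ ⟨hs0.le, le_rfl⟩ hs0.le
  obtain ⟨q, hq, hqe⟩ := hasDerivAt_radialMomentum hν Λ (abs_lt.2 ⟨by linarith, hs1⟩)
  have hqpos : 0 < q := by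
    have h2 : 0 < s * (1 - s) := mul_pos hs0 (by linarith)
    have h3 : (ν + (ν - 1) * s) * radialMomentum ν Λ s ≤ (ν + (ν - 1) * s) * δ := by
      have : 0 ≤ (ν - 1) * s := mul_nonneg (by linarith) hs0.le
      gcongr
    have h4 : (ν + (ν - 1) * s) * δ ≤ (ν + (ν - 1) * 1) * δ := by
      have : 0 ≤ ν - 1 := by linarith
      gcongr
    have h5 : -Λ * 1 ≤ -Λ * radialProfile ν Λ s := by
      have : 0 ≤ -Λ := by linarith
      gcongr
    refine pos_of_mul_pos_right ?_ h2.le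
    rw [hqe]
    linarith
  have hslope : ∀ᶠ u in 𝓝[<] s, 0 < slope (radialMomentum ν Λ) s u :=
    (hq.tendsto_slope.mono_left (nhdsWithin_mono s fun u (hu : u < s) => hu.ne)).eventually
      (lt_mem_nhds hqpos)
  obtain ⟨u, hu, hus⟩ := (hslope.and (Ioo_mem_nhdsLT hs0)).exists
  rw [slope_def_field] at hu
  have h6 : radialMomentum ν Λ u < radialMomentum ν Λ s := by
    have h7 : u - s < 0 := by linarith [hus.2]
    by_contra! hle
    exact absurd hu (not_lt.2 (div_nonpos_of_nonneg_of_nonpos (by linarith) h7.le))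
  linarith [hbefore u hus.1.le hus.2]

theorem radialProfile_tendsto_atTop {ν Λ : ℝ} (hν : 1 ≤ ν) (hΛ : Λ < 0) :
    Tendsto (radialProfile ν Λ) (𝓝[<] 1) atTop := by
  set δ := -Λ / (2 * ν) with hδ
  have hδ0 : 0 < δ := div_pos (by linarith) (by linarith)
  have hd : ∀ t ∈ Set.Ico (0 : ℝ) 1, HasDerivAt
      (fun t => radialProfile ν Λ t + δ * Real.log (1 - t))
      (radialMomentum ν Λ t / (1 - t) + δ * (-1 / (1 - t))) t := by
    intro t ht
    have h1 : HasDerivAt (fun s : ℝ => 1 - s) (-1) t := by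
      simpa using (hasDerivAt_id t).const_sub 1
    exact (hasDerivAt_radialProfile hν Λ (abs_lt.2 ⟨by linarith [ht.1], ht.2⟩)).add
      ((h1.log (by linarith [ht.2])).const_mul δ)
  -- By the momentum bound h' ≥ δ/(1 - t), which integrates to h ≥ 1 - δ log(1 - t).
  have hmono : MonotoneOn (fun t => radialProfile ν Λ t + δ * Real.log (1 - t))
      (Set.Ico (0 : ℝ) 1) := by
    refine monotoneOn_of_deriv_nonneg (convex_Ico _ _)
      (fun t ht => (hd t ht).continuousAt.continuousWithinAt)
      (fun t ht => (hd t (interior_subset ht)).differentiableAt.differentiableWithinAt) ?_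
    intro t ht
    have ht' := interior_subset ht
    rw [(hd t ht').deriv]
    have h1 := radialMomentum_gt hν hΛ ht'.1 ht'.2
    have h2 : 0 < 1 - t := by linarith [ht'.2]
    have e : radialMomentum ν Λ t / (1 - t) + δ * (-1 / (1 - t)) =
      (radialMomentum ν Λ t - δ) / (1 - t) := by ring
    rw [e]
    exact div_nonneg (by linarith) h2.le
  have hlog : Tendsto (fun t : ℝ => Real.log (1 - t)) (𝓝[<] 1) atBot := by
    refine Real.tendsto_log_nhdsGT_zero.comp ?_
    refine tendsto_nhdsWithin_iff.2 ⟨?_, ?_⟩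
    · have : Tendsto (fun t : ℝ => 1 - t) (𝓝 1) (𝓝 (1 - 1)) := tendsto_const_nhds.sub tendsto_id
      simpa using this.mono_left nhdsWithin_le_nhds
    · filter_upwards [self_mem_nhdsWithin] with t ht
      exact sub_pos.2 (Set.mem_Iio.1 ht)
  have hlim : Tendsto (fun t : ℝ => 1 + (-δ) * Real.log (1 - t)) (𝓝[<] 1) atTop :=
    tendsto_atTop_add_const_left _ _ (hlog.const_mul_atBot_of_neg (by linarith))
  refine tendsto_atTop_mono' _ ?_ hlim
  filter_upwards [Ico_mem_nhdsLT (zero_lt_one' ℝ)] with t ht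
  have := hmono ⟨le_rfl, zero_lt_one⟩ ht ht.1
  simp only [radialProfile_zero, sub_zero, Real.log_one, mul_zero, add_zero] at this
  linarith

/-! ### The hyperbolic Laplacian in Euclidean coordinates -/

theorem sq_sub_norm_sq_pos {n : ℕ} {ρ : ℝ} {x : EuclideanSpace ℝ (Fin n)}
    (hx : x ∈ Metric.ball (0 : EuclideanSpace ℝ (Fin n)) ρ) : 0 < ρ ^ 2 - ‖x‖ ^ 2 := by
  have h : ‖x‖ < ρ := by simpa using hx
  have := norm_nonneg x
  nlinarith

theorem sqrt_det_ballMetric (n : ℕ) {ρ : ℝ} {x : EuclideanSpace ℝ (Fin n)}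
    (hx : x ∈ Metric.ball (0 : EuclideanSpace ℝ (Fin n)) ρ) :
    Real.sqrt (ballMetric n ρ x).det = (2 * ρ ^ 2 / (ρ ^ 2 - ‖x‖ ^ 2)) ^ n := by
  have hq := sq_sub_norm_sq_pos hx
  rw [ballMetric, Matrix.det_smul, Matrix.det_one, mul_one, Fintype.card_fin, ← pow_mul,
    mul_comm 2 n, pow_mul]
  exact Real.sqrt_sq (by positivity)

theorem ballMetric_inv {n : ℕ} {ρ : ℝ} (hρ : 0 < ρ) {x : EuclideanSpace ℝ (Fin n)}
    (hx : x ∈ Metric.ball (0 : EuclideanSpace ℝ (Fin n)) ρ) :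
    (ballMetric n ρ x)⁻¹ =
      ((2 * ρ ^ 2 / (ρ ^ 2 - ‖x‖ ^ 2)) ^ 2)⁻¹ • (1 : Matrix (Fin n) (Fin n) ℝ) := by
  have hq := sq_sub_norm_sq_pos hx
  refine Matrix.inv_eq_right_inv ?_
  rw [ballMetric, Matrix.smul_mul, Matrix.mul_smul, smul_smul, Matrix.one_mul,
    mul_inv_cancel₀ (by positivity), one_smul]

/-- The second partial derivative `∂_i ∂_i f`. -/
noncomputable def secondPartial {n : ℕ} (f : EuclideanSpace ℝ (Fin n) → ℝ)
    (x : EuclideanSpace ℝ (Fin n)) (i : Fin n) : ℝ :=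
  fderiv ℝ (fun y => fderiv ℝ f y (EuclideanSpace.single i 1)) x (EuclideanSpace.single i 1)

theorem hasFDerivAt_norm_sq' {n : ℕ} (x : EuclideanSpace ℝ (Fin n)) :
    HasFDerivAt (fun y : EuclideanSpace ℝ (Fin n) => ‖y‖ ^ 2) (2 • innerSL ℝ x) x :=
  (hasStrictFDerivAt_norm_sq x).hasFDerivAt

theorem differentiableAt_partial {n : ℕ} {f : EuclideanSpace ℝ (Fin n) → ℝ}
    {x : EuclideanSpace ℝ (Fin n)} (hf : ContDiffAt ℝ 2 f x) (v : EuclideanSpace ℝ (Fin n)) :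
    DifferentiableAt ℝ (fun y => fderiv ℝ f y v) x := by
  have : ContDiffAt ℝ 1 (fderiv ℝ f) x := hf.fderiv_right (by norm_num)
  exact (this.differentiableAt (by norm_num)).clm_apply (differentiableAt_const v)

/-- For the conformal factor w = 2ρ²/(ρ² - |x|²) in dimension m + 2, the weight √(det g) g^{ij} is
w^m δ_ij. Its gradient gives the first-order term, and writing the dimension as m + 2 keeps the
exponent a natural number. -/
theorem laplaceBeltrami_ballMetric (m : ℕ) {ρ : ℝ} (hρ : 0 < ρ)
    {f : EuclideanSpace ℝ (Fin (m + 2)) → ℝ} {x : EuclideanSpace ℝ (Fin (m + 2))}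
    (hx : x ∈ Metric.ball (0 : EuclideanSpace ℝ (Fin (m + 2))) ρ) (hf : ContDiffAt ℝ 2 f x) :
    laplaceBeltrami (ballMetric (m + 2) ρ) f x =
      ((ρ ^ 2 - ‖x‖ ^ 2) / (2 * ρ ^ 2)) ^ 2 * ∑ i, (secondPartial f x i +
        2 * m * x i / (ρ ^ 2 - ‖x‖ ^ 2) * fderiv ℝ f x (EuclideanSpace.single i 1)) := by
  have hq := sq_sub_norm_sq_pos hx
  have hflux : ∀ i, (fun y => Real.sqrt (ballMetric (m + 2) ρ y).det *
      ∑ j, (ballMetric (m + 2) ρ y)⁻¹ i j * fderiv ℝ f y (EuclideanSpace.single j 1)) =ᶠ[𝓝 x]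
      fun y => (2 * ρ ^ 2 / (ρ ^ 2 - ‖y‖ ^ 2)) ^ m * fderiv ℝ f y (EuclideanSpace.single i 1) := by
    intro i
    filter_upwards [Metric.isOpen_ball.mem_nhds hx] with y hy
    have hqy := sq_sub_norm_sq_pos hy
    rw [sqrt_det_ballMetric _ hy, ballMetric_inv hρ hy]
    simp only [Matrix.smul_apply, Matrix.one_apply, smul_eq_mul, mul_ite, mul_one, mul_zero,
      ite_mul, zero_mul, Finset.sum_ite_eq, Finset.mem_univ, if_true]
    rw [← mul_assoc, pow_add, mul_assoc (_ ^ m), mul_inv_cancel₀ (by positivity), mul_one]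
  have hw : HasFDerivAt (fun y : EuclideanSpace ℝ (Fin (m + 2)) =>
      (2 * ρ ^ 2 / (ρ ^ 2 - ‖y‖ ^ 2)) ^ m)
      (((2 * ρ ^ 2 / (ρ ^ 2 - ‖x‖ ^ 2)) ^ m * (m / (ρ ^ 2 - ‖x‖ ^ 2))) • (2 • innerSL ℝ x)) x := by
    have hd : HasDerivAt (fun s : ℝ => (2 * ρ ^ 2 / (ρ ^ 2 - s)) ^ m)
        ((2 * ρ ^ 2 / (ρ ^ 2 - ‖x‖ ^ 2)) ^ m * (m / (ρ ^ 2 - ‖x‖ ^ 2))) (‖x‖ ^ 2) := by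
      have h0 : HasDerivAt (fun s : ℝ => 2 * ρ ^ 2 / (ρ ^ 2 - s))
          (2 * ρ ^ 2 / (ρ ^ 2 - ‖x‖ ^ 2) * (1 / (ρ ^ 2 - ‖x‖ ^ 2))) (‖x‖ ^ 2) := by
        refine ((hasDerivAt_const (‖x‖ ^ 2) (2 * ρ ^ 2)).div
          ((hasDerivAt_id (‖x‖ ^ 2)).const_sub (ρ ^ 2)) hq.ne').congr_deriv ?_
        simp only [id_eq]
        field_simp
        ring
      refine (h0.pow m).congr_deriv ?_
      rcases m with _ | m
      · simp
      · rw [Nat.add_sub_cancel, pow_succ]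
        ring
    exact HasDerivAt.comp_hasFDerivAt (f := fun y : EuclideanSpace ℝ (Fin (m + 2)) => ‖y‖ ^ 2) x hd
      (hasFDerivAt_norm_sq' x)
  have hi : ∀ i, fderiv ℝ (fun y => Real.sqrt (ballMetric (m + 2) ρ y).det *
      ∑ j, (ballMetric (m + 2) ρ y)⁻¹ i j * fderiv ℝ f y (EuclideanSpace.single j 1)) x
        (EuclideanSpace.single i 1) = (2 * ρ ^ 2 / (ρ ^ 2 - ‖x‖ ^ 2)) ^ m * (secondPartial f x i +
        2 * m * x i / (ρ ^ 2 - ‖x‖ ^ 2) * fderiv ℝ f x (EuclideanSpace.single i 1)) := by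
    intro i
    have hm : HasFDerivAt (fun y => (2 * ρ ^ 2 / (ρ ^ 2 - ‖y‖ ^ 2)) ^ m *
        fderiv ℝ f y (EuclideanSpace.single i 1)) _ x :=
      hw.mul (differentiableAt_partial hf _).hasFDerivAt
    rw [(hflux i).fderiv_eq, hm.fderiv]
    simp [secondPartial, EuclideanSpace.inner_single_right]
    ring
  rw [laplaceBeltrami, Finset.sum_congr rfl fun i _ => hi i, ← Finset.mul_sum, ← mul_assoc,
    sqrt_det_ballMetric _ hx]
  congr 1
  rw [pow_add]
  field_simp

/-- The derivatives of h are required only near t. Hence this serves both the series solution,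
origin included, and unknown radial solutions, whose profile is controlled only for 0 < t < 1. -/
theorem laplaceBeltrami_radial (m : ℕ) {ρ : ℝ} (hρ : 0 < ρ) {h h1 : ℝ → ℝ} {h2 : ℝ}
    {f : EuclideanSpace ℝ (Fin (m + 2)) → ℝ} {x : EuclideanSpace ℝ (Fin (m + 2))} {t : ℝ}
    (hx : x ∈ Metric.ball (0 : EuclideanSpace ℝ (Fin (m + 2))) ρ) (hf : ContDiffAt ℝ 2 f x)
    (ht : t = ‖x‖ ^ 2 / ρ ^ 2) (hd1 : ∀ᶠ s in 𝓝 t, HasDerivAt h (h1 s) s)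
    (hd2 : HasDerivAt h1 h2 t) (hfh : ∀ᶠ y in 𝓝 x, f y = h (‖y‖ ^ 2 / ρ ^ 2)) :
    ρ ^ 2 * laplaceBeltrami (ballMetric (m + 2) ρ) f x =
      (1 - t) ^ 2 * (t * h2 + (m + 2) / 2 * h1 t) + m * (1 - t) * t * h1 t := by
  have hq := sq_sub_norm_sq_pos hx
  have hN : ∀ y : EuclideanSpace ℝ (Fin (m + 2)),
      HasFDerivAt (fun y : EuclideanSpace ℝ (Fin (m + 2)) => ‖y‖ ^ 2 / ρ ^ 2)
        ((ρ ^ 2)⁻¹ • (2 • innerSL ℝ y)) y := by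
    intro y
    simpa only [div_eq_mul_inv] using (hasFDerivAt_norm_sq' y).mul_const ((ρ ^ 2)⁻¹)
  have hcont : Tendsto (fun y : EuclideanSpace ℝ (Fin (m + 2)) => ‖y‖ ^ 2 / ρ ^ 2) (𝓝 x) (𝓝 t) :=
    ht ▸ (hN x).continuousAt
  have hD : ∀ᶠ y in 𝓝 x, ∀ i, fderiv ℝ f y (EuclideanSpace.single i 1) =
      h1 (‖y‖ ^ 2 / ρ ^ 2) * (2 / ρ ^ 2 * y i) := by
    filter_upwards [hcont.eventually hd1, hfh.eventually_nhds] with y hy hy' i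
    have hc : HasFDerivAt (fun y : EuclideanSpace ℝ (Fin (m + 2)) => h (‖y‖ ^ 2 / ρ ^ 2)) _ y :=
      hy.comp_hasFDerivAt y (hN y)
    rw [Filter.EventuallyEq.fderiv_eq hy', hc.fderiv]
    simp [EuclideanSpace.inner_single_right]
    left
    ring
  have hD2 : ∀ i, secondPartial f x i =
      h2 * (4 / ρ ^ 4) * x i ^ 2 + h1 t * (2 / ρ ^ 2) := by
    intro i
    have e : (fun y => fderiv ℝ f y (EuclideanSpace.single i 1)) =ᶠ[𝓝 x]
        fun y => h1 (‖y‖ ^ 2 / ρ ^ 2) * (2 / ρ ^ 2 * y i) := by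
      filter_upwards [hD] with y hy using hy i
    have hc : HasFDerivAt (fun y : EuclideanSpace ℝ (Fin (m + 2)) => y i)
      (EuclideanSpace.proj i : EuclideanSpace ℝ (Fin (m + 2)) →L[ℝ] ℝ) x :=
      (EuclideanSpace.proj i : EuclideanSpace ℝ (Fin (m + 2)) →L[ℝ] ℝ).hasFDerivAt
    have hd2' : HasDerivAt h1 h2 (‖x‖ ^ 2 / ρ ^ 2) := ht ▸ hd2
    have hm : HasFDerivAt (fun y : EuclideanSpace ℝ (Fin (m + 2)) =>
        h1 (‖y‖ ^ 2 / ρ ^ 2) * (2 / ρ ^ 2 * y i)) _ x :=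
      (hd2'.comp_hasFDerivAt x (hN x)).mul (hc.const_mul (2 / ρ ^ 2))
    rw [secondPartial, e.fderiv_eq, hm.fderiv]
    simp [EuclideanSpace.inner_single_right, ← ht]
    field_simp
    ring
  have hsum : ∑ i, x i ^ 2 = ρ ^ 2 * t := by
    rw [ht, EuclideanSpace.norm_sq_eq]
    simp only [Real.norm_eq_abs, sq_abs]
    field_simp
  have hqt : ρ ^ 2 - ‖x‖ ^ 2 = ρ ^ 2 * (1 - t) := by rw [ht]; field_simp
  have ht1 : 0 < 1 - t := by
    rw [hqt] at hq; exact pos_of_mul_pos_right hq (by positivity)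
  have e : ∀ i, secondPartial f x i +
        2 * m * x i / (ρ ^ 2 - ‖x‖ ^ 2) * fderiv ℝ f x (EuclideanSpace.single i 1) =
      (h2 * (4 / ρ ^ 4) + 4 * m * h1 t / (ρ ^ 4 * (1 - t))) * x i ^ 2 + h1 t * (2 / ρ ^ 2) := by
    intro i
    rw [hD2, hD.self_of_nhds i, hqt, ← ht]
    field_simp
    ring
  rw [laplaceBeltrami_ballMetric m hρ hx hf, Finset.sum_congr rfl fun i _ => e i,
    Finset.sum_add_distrib, ← Finset.mul_sum, hsum, hqt, Finset.sum_const, Finset.card_univ,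
    Fintype.card_fin, nsmul_eq_mul]
  push_cast
  field_simp
  ring

/-! ### Hyperbolic radius and the radial eigenfunction on the ball -/

theorem norm_lt_of_mem_ball {n : ℕ} {ρ : ℝ} {x : EuclideanSpace ℝ (Fin n)}
    (hx : x ∈ Metric.ball (0 : EuclideanSpace ℝ (Fin n)) ρ) : ‖x‖ < ρ := by simpa using hx

theorem norm_sq_div_lt_one {n : ℕ} {ρ : ℝ} (hρ : 0 < ρ) {x : EuclideanSpace ℝ (Fin n)}
    (hx : x ∈ Metric.ball (0 : EuclideanSpace ℝ (Fin n)) ρ) : ‖x‖ ^ 2 / ρ ^ 2 < 1 := by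
  rw [div_lt_one (by positivity)]
  linarith [sq_sub_norm_sq_pos hx]

theorem hypRadius_zero {n : ℕ} {ρ : ℝ} (hρ : 0 < ρ) :
    hypRadius ρ (0 : EuclideanSpace ℝ (Fin n)) = 0 := by
  simp [hypRadius, hρ.ne']

theorem hypRadius_eq_of_norm_eq {n : ℕ} (ρ : ℝ) {x y : EuclideanSpace ℝ (Fin n)}
    (h : ‖x‖ = ‖y‖) : hypRadius ρ x = hypRadius ρ y := by
  simp [hypRadius, h]

/-- The value `tanh (r / 2ρ) ^ 2` of `|x|² / ρ²` at hyperbolic distance `r`. -/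
noncomputable def radialCoord (ρ r : ℝ) : ℝ :=
  ((Real.exp (r / ρ) - 1) / (Real.exp (r / ρ) + 1)) ^ 2

theorem radialCoord_zero (ρ : ℝ) : radialCoord ρ 0 = 0 := by simp [radialCoord]

theorem radialCoord_hypRadius {n : ℕ} {ρ : ℝ} (hρ : 0 < ρ) {x : EuclideanSpace ℝ (Fin n)}
    (hx : x ∈ Metric.ball (0 : EuclideanSpace ℝ (Fin n)) ρ) :
    radialCoord ρ (hypRadius ρ x) = ‖x‖ ^ 2 / ρ ^ 2 := by
  have h := norm_lt_of_mem_ball hx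
  have h0 := norm_nonneg x
  have h1 : 0 < ρ - ‖x‖ := by linarith
  have e : Real.exp (hypRadius ρ x / ρ) = (ρ + ‖x‖) / (ρ - ‖x‖) := by
    rw [hypRadius, mul_div_cancel_left₀ _ hρ.ne', Real.exp_log (by positivity)]
  rw [radialCoord, e, ← div_pow]
  congr 1
  have h2 : (ρ + ‖x‖) / (ρ - ‖x‖) + 1 ≠ 0 := by positivity
  rw [div_eq_div_iff h2 hρ.ne']
  field_simp
  ring

/-- Every r ≥ 0 is attained, so equality of two eigenfunctions on the ball yields equality of their
profiles on all of [0, ∞). -/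
theorem exists_hypRadius_eq (n : ℕ) {ρ r : ℝ} (hρ : 0 < ρ) (hr : 0 ≤ r) :
    ∃ x ∈ Metric.ball (0 : EuclideanSpace ℝ (Fin (n + 1))) ρ, hypRadius ρ x = r := by
  set E := Real.exp (r / ρ) with hE
  have hE1 : 1 ≤ E := Real.one_le_exp (by positivity)
  have hs : 0 ≤ (E - 1) / (E + 1) := div_nonneg (by linarith) (by linarith)
  have hn : ‖EuclideanSpace.single (0 : Fin (n + 1)) (ρ * ((E - 1) / (E + 1)))‖ =
      ρ * ((E - 1) / (E + 1)) := by
    rw [PiLp.norm_single, Real.norm_eq_abs, abs_of_nonneg (by positivity)]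
  refine ⟨EuclideanSpace.single 0 (ρ * ((E - 1) / (E + 1))), ?_, ?_⟩
  · rw [mem_ball_zero_iff, hn]
    have : (E - 1) / (E + 1) < 1 := (div_lt_one (by linarith)).2 (by linarith)
    nlinarith
  · have e : (ρ + ρ * ((E - 1) / (E + 1))) / (ρ - ρ * ((E - 1) / (E + 1))) = E := by
      have h1 : E + 1 ≠ 0 := by linarith
      have h2 : ρ - ρ * ((E - 1) / (E + 1)) ≠ 0 := by
        have : ρ - ρ * ((E - 1) / (E + 1)) = 2 * ρ / (E + 1) := by field_simp; ring
        rw [this]; positivity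
      rw [div_eq_iff h2]
      field_simp
      ring
    rw [hypRadius, hn, e, hE, Real.log_exp, mul_div_cancel₀ _ hρ.ne']

theorem radialCoord_tendsto {ρ : ℝ} (hρ : 0 < ρ) :
    Tendsto (radialCoord ρ) atTop (𝓝[<] 1) := by
  have hexp : Tendsto (fun r => Real.exp (r / ρ)) atTop atTop :=
    Real.tendsto_exp_atTop.comp (tendsto_id.atTop_div_const hρ)
  have h1 : Tendsto (fun r => 1 - 2 / (Real.exp (r / ρ) + 1)) atTop (𝓝 (1 - 0)) :=
    tendsto_const_nhds.sub
      (tendsto_const_nhds.div_atTop (tendsto_atTop_add_const_right _ 1 hexp))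
  have e : ∀ r, (Real.exp (r / ρ) - 1) / (Real.exp (r / ρ) + 1) =
      1 - 2 / (Real.exp (r / ρ) + 1) := by
    intro r
    have : Real.exp (r / ρ) + 1 ≠ 0 := by positivity
    field_simp
    ring
  refine tendsto_nhdsWithin_iff.2 ⟨?_, Eventually.of_forall fun r => ?_⟩
  · have h2 : Tendsto (fun r => (1 - 2 / (Real.exp (r / ρ) + 1)) ^ 2) atTop (𝓝 1) := by
      simpa using h1.pow 2
    exact h2.congr fun r => by rw [radialCoord, e]
  · have hp := Real.exp_pos (r / ρ)
    rw [Set.mem_Iio, radialCoord, div_pow, div_lt_one (by positivity)]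
    nlinarith

theorem contDiff_norm_sq_div {n : ℕ} (ρ : ℝ) :
    ContDiff ℝ 2 fun x : EuclideanSpace ℝ (Fin n) => ‖x‖ ^ 2 / ρ ^ 2 :=
  (contDiff_norm_sq ℝ).div_const _

theorem isNormalizedRadialEigenfunction_radialProfile (m : ℕ) {ρ : ℝ} (hρ : 0 < ρ) (μ : ℝ) :
    IsNormalizedRadialEigenfunction (m + 2) ρ μ
      fun r => radialProfile (((m : ℝ) + 2) / 2) (μ * ρ ^ 2) (radialCoord ρ r) := by
  set ν := ((m : ℝ) + 2) / 2 with hν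
  set Λ := μ * ρ ^ 2 with hΛ
  have hm : (0 : ℝ) ≤ m := m.cast_nonneg
  have hν1 : 1 ≤ ν := by rw [hν]; linarith
  have hf : ∀ x ∈ Metric.ball (0 : EuclideanSpace ℝ (Fin (m + 2))) ρ,
      radialProfile ν Λ (radialCoord ρ (hypRadius ρ x)) = radialProfile ν Λ (‖x‖ ^ 2 / ρ ^ 2) :=
    fun x hx => by rw [radialCoord_hypRadius hρ hx]
  have habs : ∀ x ∈ Metric.ball (0 : EuclideanSpace ℝ (Fin (m + 2))) ρ,
      |‖x‖ ^ 2 / ρ ^ 2| < 1 := fun x hx => by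
    rw [abs_of_nonneg (by positivity)]; exact norm_sq_div_lt_one hρ hx
  have hC : ContDiffOn ℝ 2 (fun x : EuclideanSpace ℝ (Fin (m + 2)) =>
      radialProfile ν Λ (radialCoord ρ (hypRadius ρ x))) (Metric.ball 0 ρ) :=
    ((contDiffOn_radialProfile hν1 Λ).comp (contDiff_norm_sq_div ρ).contDiffOn habs).congr hf
  refine ⟨⟨hC, fun x hx => ?_⟩, by simp [radialCoord_zero, radialProfile_zero]⟩
  set t := ‖x‖ ^ 2 / ρ ^ 2 with ht
  have ht1 : t < 1 := norm_sq_div_lt_one hρ hx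
  have hne : 1 - t ≠ 0 := by linarith
  obtain ⟨q, hq, hqe⟩ := hasDerivAt_radialMomentum hν1 Λ (habs x hx)
  have hd1 : ∀ᶠ s in 𝓝 t, HasDerivAt (radialProfile ν Λ) (radialMomentum ν Λ s / (1 - s)) s := by
    filter_upwards [(isOpen_lt continuous_abs continuous_const).mem_nhds (habs x hx)] with s hs
    exact hasDerivAt_radialProfile hν1 Λ hs
  have hs : HasDerivAt (fun s : ℝ => 1 - s) (-1) t := by
    simpa using (hasDerivAt_id t).const_sub 1
  have key := laplaceBeltrami_radial m hρ hx (hC.contDiffAt (Metric.isOpen_ball.mem_nhds hx)) ht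
    hd1 (hq.div hs hne) (by
      filter_upwards [Metric.isOpen_ball.mem_nhds hx] with y hy using hf y hy)
  rw [← hν] at key
  have h2 : ρ ^ 2 ≠ 0 := by positivity
  have hmν : (m : ℝ) = 2 * ν - 2 := by rw [hν]; ring
  have e : (1 - t) ^ 2 * (t * ((q * (1 - t) - radialMomentum ν Λ t * -1) / (1 - t) ^ 2) +
      ν * (radialMomentum ν Λ t / (1 - t))) +
      m * (1 - t) * t * (radialMomentum ν Λ t / (1 - t)) = -Λ * radialProfile ν Λ t := by
    field_simp
    rw [hmν]
    linear_combination hqe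
  refine mul_left_cancel₀ h2 ?_
  simp only
  rw [hf x hx, mul_add, key, e, hΛ]
  ring

/-! ### Uniqueness of the radial eigenfunction -/

/-- Nothing is assumed about ψ itself; regularity is read off from its restriction g to a diameter,
which is C² and even. Since H(t) = g(ρ√t), the product √t H' tends to ρg'(0)/2 = 0, a substitute for
differentiability of H at 0. -/
theorem radial_ode (m : ℕ) {ρ μ : ℝ} (hρ : 0 < ρ) {ψ : ℝ → ℝ}
    (hψ : SolvesEigenEquation (m + 2) ρ μ fun x => ψ (hypRadius ρ x)) :
    ∃ H H1 H2 : ℝ → ℝ,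
      (∀ x ∈ Metric.ball (0 : EuclideanSpace ℝ (Fin (m + 2))) ρ,
        ψ (hypRadius ρ x) = H (‖x‖ ^ 2 / ρ ^ 2)) ∧
      (∀ t ∈ Set.Ioo (0 : ℝ) 1, HasDerivAt H (H1 t) t ∧ HasDerivAt H1 (H2 t) t ∧
        (1 - t) ^ 2 * (t * H2 t + (m + 2) / 2 * H1 t) + m * (1 - t) * t * H1 t +
          μ * ρ ^ 2 * H t = 0) ∧
      Tendsto H (𝓝[>] 0) (𝓝 (ψ 0)) ∧
      Tendsto (fun t => Real.sqrt t * H1 t) (𝓝[>] 0) (𝓝 0) := by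
  obtain ⟨hC, hE⟩ := hψ
  set e : EuclideanSpace ℝ (Fin (m + 2)) := EuclideanSpace.single 0 1 with he
  have hen : ‖e‖ = 1 := by simp [he]
  set g : ℝ → ℝ := fun s => ψ (hypRadius ρ (s • e)) with hg
  have hmem : ∀ s : ℝ, |s| < ρ → s • e ∈ Metric.ball (0 : EuclideanSpace ℝ (Fin (m + 2))) ρ := by
    intro s hs
    simpa [norm_smul, hen] using hs
  have ho : IsOpen {s : ℝ | |s| < ρ} := isOpen_lt continuous_abs continuous_const
  have hgC : ContDiffOn ℝ 2 g {s | |s| < ρ} :=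
    hC.comp (contDiff_id.smul contDiff_const).contDiffOn fun s hs => hmem s hs
  have hgC1 : ContDiffOn ℝ 1 (deriv g) {s | |s| < ρ} := hgC.deriv_of_isOpen ho (by norm_num)
  have hg0 : |(0 : ℝ)| < ρ := by simpa using hρ
  have hgeven : ∀ s, g (-s) = g s := fun s => by
    simp only [hg]; rw [hypRadius_eq_of_norm_eq ρ (by simp : ‖(-s) • e‖ = ‖s • e‖)]
  have hg'0 : deriv g 0 = 0 := by
    have h1 := deriv_comp_neg g 0
    simp only [hgeven, neg_zero] at h1
    have h1' : deriv g 0 = -deriv g 0 := h1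
    linarith
  have hgd : ∀ s, |s| < ρ → HasDerivAt g (deriv g s) s := fun s hs =>
    ((hgC.contDiffAt (ho.mem_nhds hs)).differentiableAt (by norm_num)).hasDerivAt
  have hgd2 : ∀ s, |s| < ρ → HasDerivAt (deriv g) (deriv (deriv g) s) s := fun s hs =>
    ((hgC1.contDiffAt (ho.mem_nhds hs)).differentiableAt (by norm_num)).hasDerivAt
  have hsm : ∀ t ∈ Set.Ioo (0 : ℝ) 1, |ρ * Real.sqrt t| < ρ := by
    intro t ht
    have : Real.sqrt t < 1 := by
      rw [Real.sqrt_lt' one_pos]; simpa using ht.2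
    rw [abs_of_nonneg (by positivity)]
    nlinarith
  have hsd : ∀ t ∈ Set.Ioo (0 : ℝ) 1,
      HasDerivAt (fun t => ρ * Real.sqrt t) (ρ * (1 / (2 * Real.sqrt t))) t := fun t ht =>
    (Real.hasDerivAt_sqrt ht.1.ne').const_mul ρ
  have hsd2 : ∀ t ∈ Set.Ioo (0 : ℝ) 1,
      ∃ d, HasDerivAt (fun t => ρ * (1 / (2 * Real.sqrt t))) d t := by
    intro t ht
    have hpos : 0 < Real.sqrt t := Real.sqrt_pos.2 ht.1
    have h1 := (hasDerivAt_const t (1 : ℝ)).div ((Real.hasDerivAt_sqrt ht.1.ne').const_mul 2)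
      (by positivity)
    exact ⟨_, h1.const_mul ρ⟩
  choose! d hd using hsd2
  set H : ℝ → ℝ := fun t => g (ρ * Real.sqrt t) with hH
  set H1 : ℝ → ℝ := fun t => deriv g (ρ * Real.sqrt t) * (ρ * (1 / (2 * Real.sqrt t))) with hH1
  have hfH : ∀ x : EuclideanSpace ℝ (Fin (m + 2)), ψ (hypRadius ρ x) = H (‖x‖ ^ 2 / ρ ^ 2) := by
    intro x
    simp only [hH, hg]
    have : ρ * Real.sqrt (‖x‖ ^ 2 / ρ ^ 2) = ‖x‖ := by
      rw [← div_pow, Real.sqrt_sq (by positivity)]; field_simp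
    rw [this]
    exact congrArg ψ (hypRadius_eq_of_norm_eq ρ (by simp [norm_smul, hen]))
  have hHd : ∀ t ∈ Set.Ioo (0 : ℝ) 1, HasDerivAt H (H1 t) t := fun t ht =>
    HasDerivAt.comp (h := fun t => ρ * Real.sqrt t) t (hgd _ (hsm t ht)) (hsd t ht)
  have hsq0 : Tendsto (fun t => ρ * Real.sqrt t) (𝓝[>] 0) (𝓝 0) := by
    have : Continuous fun t => ρ * Real.sqrt t := by fun_prop
    simpa using (this.tendsto 0).mono_left (nhdsWithin_le_nhds (s := Set.Ioi 0))
  refine ⟨H, H1, fun t => (deriv (deriv g) (ρ * Real.sqrt t) * (ρ * (1 / (2 * Real.sqrt t)))) *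
    (ρ * (1 / (2 * Real.sqrt t))) + deriv g (ρ * Real.sqrt t) * d t, fun x _ => hfH x, ?_, ?_, ?_⟩
  · intro t ht
    have h2 := ((hgd2 _ (hsm t ht)).comp t (hsd t ht)).mul (hd t ht)
    refine ⟨hHd t ht, h2, ?_⟩
    have hx := hmem _ (hsm t ht)
    have hn : t = ‖(ρ * Real.sqrt t) • e‖ ^ 2 / ρ ^ 2 := by
      rw [norm_smul, hen, mul_one, Real.norm_eq_abs, sq_abs, mul_pow, Real.sq_sqrt ht.1.le]
      field_simp
    have key := laplaceBeltrami_radial m hρ hx (hC.contDiffAt (Metric.isOpen_ball.mem_nhds hx)) hn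
      (h := H) (h1 := H1) (by
        filter_upwards [isOpen_Ioo.mem_nhds ht] with s hs using hHd s hs) h2
      (Eventually.of_forall hfH)
    have h3 := hE _ hx
    simp only at h3
    rw [hfH (_ • e), ← hn] at h3
    simp only [Function.comp_apply] at key
    linear_combination ρ ^ 2 * h3 - key
  · have h1 := (hgd 0 hg0).continuousAt.tendsto.comp hsq0
    have h2 : g 0 = ψ 0 := by simp [hg, hypRadius_zero hρ]
    rwa [h2] at h1
  · have h1 := ((hgd2 0 hg0).continuousAt.tendsto.comp hsq0).mul_const (ρ / 2)
    rw [hg'0, zero_mul] at h1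
    refine h1.congr' ?_
    filter_upwards [self_mem_nhdsWithin] with t ht
    have : 0 < Real.sqrt t := Real.sqrt_pos.2 ht
    simp only [hH1, Function.comp_apply]
    field_simp

theorem IsNormalizedRadialEigenfunction.eqOn {m : ℕ} {ρ μ : ℝ} (hρ : 0 < ρ) {φ ψ : ℝ → ℝ}
    (hψ : IsNormalizedRadialEigenfunction (m + 2) ρ μ ψ)
    (hφ : IsNormalizedRadialEigenfunction (m + 2) ρ μ φ) : Set.EqOn ψ φ (Set.Ici 0) := by
  obtain ⟨H, H1, H2, hfH, hH, hH0, hH10⟩ := radial_ode m hρ hψ.1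
  obtain ⟨K, K1, K2, hfK, hK, hK0, hK10⟩ := radial_ode m hρ hφ.1
  rw [hψ.2] at hH0
  rw [hφ.2] at hK0
  have hm : (0 : ℝ) ≤ m := m.cast_nonneg
  have hone : ∀ t : ℝ, HasDerivAt (fun s : ℝ => 1 - s) (-1) t := fun t => by
    simpa using (hasDerivAt_id t).const_sub 1
  have hE : ∀ t ∈ Set.Ioo (0 : ℝ) 1, HasDerivAt
      (fun t => t * ((1 - t) * (H1 t - K1 t)) ^ 2 + (H t - K t) ^ 2)
      (((1 - t) * (H1 t - K1 t)) ^ 2 + 2 * t * ((1 - t) * (H1 t - K1 t)) *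
        (-(H1 t - K1 t) + (1 - t) * (H2 t - K2 t)) + 2 * (H t - K t) * (H1 t - K1 t)) t := by
    intro t ht
    obtain ⟨a1, a2, -⟩ := hH t ht
    obtain ⟨b1, b2, -⟩ := hK t ht
    refine (((hasDerivAt_id t).mul (((hone t).mul (a2.sub b2)).pow 2)).add
      ((a1.sub b1).pow 2)).congr_deriv ?_
    simp only [id_eq, Pi.mul_apply, Pi.pow_apply, Pi.sub_apply]
    push_cast
    ring
  -- With u = H - K and p = (1 - t)u', the left side equals -(m + 1)(1 + t)p² + 2(1 - Λ)up.
  -- Completing the square gives the constant (1 - Λ)².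
  have hle : ∀ t ∈ Set.Ioo (0 : ℝ) 1,
      (1 - t) * (((1 - t) * (H1 t - K1 t)) ^ 2 + 2 * t * ((1 - t) * (H1 t - K1 t)) *
        (-(H1 t - K1 t) + (1 - t) * (H2 t - K2 t)) + 2 * (H t - K t) * (H1 t - K1 t)) ≤
      (1 - μ * ρ ^ 2) ^ 2 * (t * ((1 - t) * (H1 t - K1 t)) ^ 2 + (H t - K t) ^ 2) := by
    intro t ht
    obtain ⟨-, -, a⟩ := hH t ht
    obtain ⟨-, -, b⟩ := hK t ht
    set u := H t - K t with hu
    set u1 := H1 t - K1 t with hu1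
    set p := (1 - t) * u1 with hp
    have e : (1 - t) * (p ^ 2 + 2 * t * p * (-u1 + (1 - t) * (H2 t - K2 t)) + 2 * u * u1) =
        -((m + 1) * (1 + t)) * p ^ 2 + 2 * (1 - μ * ρ ^ 2) * u * p := by
      rw [hp, hu1, hu]
      linear_combination (2 * ((1 - t) * (H1 t - K1 t))) * (a - b)
    rw [e]
    have h1 : 1 * p ^ 2 ≤ (m + 1) * (1 + t) * p ^ 2 := by
      gcongr; nlinarith [ht.1, mul_nonneg hm ht.1.le]
    have h2 : 0 ≤ (1 - μ * ρ ^ 2) ^ 2 * (t * p ^ 2) :=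
      mul_nonneg (sq_nonneg _) (mul_nonneg ht.1.le (sq_nonneg _))
    linarith [sq_nonneg ((1 - μ * ρ ^ 2) * u - p)]
  have h0 : Tendsto (fun t => t * ((1 - t) * (H1 t - K1 t)) ^ 2 + (H t - K t) ^ 2)
      (𝓝[>] 0) (𝓝 0) := by
    have hc : Tendsto (fun t : ℝ => 1 - t) (𝓝[>] 0) (𝓝 1) := by
      simpa using (hone 0).continuousAt.tendsto.mono_left (nhdsWithin_le_nhds (s := Set.Ioi 0))
    have h1 := ((hc.mul (hH10.sub hK10)).pow 2).add ((hH0.sub hK0).pow 2)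
    simp only [sub_self, mul_zero, ne_eq, OfNat.ofNat_ne_zero, not_false_eq_true, zero_pow,
      add_zero] at h1
    refine h1.congr' ?_
    filter_upwards [self_mem_nhdsWithin] with t ht
    have := Real.sq_sqrt (le_of_lt ht)
    linear_combination ((1 - t) * (H1 t - K1 t)) ^ 2 * this
  have hHK : ∀ t ∈ Set.Ioo (0 : ℝ) 1, H t = K t := by
    intro t ht
    have h1 : 0 < 1 - t := by linarith [ht.2]
    have k := mul_rpow_le_of_deriv_le hE hle h0 ht
    have k2 : t * ((1 - t) * (H1 t - K1 t)) ^ 2 + (H t - K t) ^ 2 ≤ 0 :=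
      nonpos_of_mul_nonpos_left k (Real.rpow_pos_of_pos h1 _)
    have k3 : 0 ≤ t * ((1 - t) * (H1 t - K1 t)) ^ 2 := mul_nonneg ht.1.le (sq_nonneg _)
    have k4 : (H t - K t) ^ 2 = 0 := le_antisymm (by linarith) (sq_nonneg _)
    exact sub_eq_zero.1 (pow_eq_zero_iff two_ne_zero |>.1 k4)
  intro r hr
  obtain ⟨x, hx, rfl⟩ := exists_hypRadius_eq (m + 1) hρ hr
  rcases eq_or_ne x 0 with rfl | hne
  · rw [hypRadius_zero hρ, hψ.2, hφ.2]
  · rw [hfH x hx, hfK x hx]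
    exact hHK _ ⟨by positivity, norm_sq_div_lt_one hρ hx⟩

/-! ### Maximum principle and nonexistence for μ ≤ 0 -/

/-- Were it positive, the restriction to a coordinate line would have a local minimum as well as a
local maximum. It would then be locally constant, with zero second derivative. -/
theorem secondPartial_nonpos_of_isLocalMax {n : ℕ} {u : EuclideanSpace ℝ (Fin n) → ℝ}
    {x : EuclideanSpace ℝ (Fin n)} (hu : ContDiffAt ℝ 2 u x) (hmax : IsLocalMax u x) (i : Fin n) :
    secondPartial u x i ≤ 0 := by
  by_contra! hpos
  set e : EuclideanSpace ℝ (Fin n) := EuclideanSpace.single i 1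
  have hline : ∀ s : ℝ, HasDerivAt (fun s : ℝ => x + s • e) e s := fun s => by
    simpa using ((hasDerivAt_id s).smul_const e).const_add x
  have hx0 : x + (0 : ℝ) • e = x := by simp
  have ht : Tendsto (fun s : ℝ => x + s • e) (𝓝 0) (𝓝 x) := by
    simpa using (hline 0).continuousAt.tendsto
  have hdiff : ∀ᶠ y in 𝓝 x, DifferentiableAt ℝ u y := by
    filter_upwards [hu.eventually (by simp)] with y hy using hy.differentiableAt (by norm_num)
  have hderiv : deriv (fun s : ℝ => u (x + s • e)) =ᶠ[𝓝 0] fun s => fderiv ℝ u (x + s • e) e := by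
    filter_upwards [ht.eventually hdiff] with s hs
    exact (hs.hasFDerivAt.comp_hasDerivAt s (hline s)).deriv
  have hd2 : HasDerivAt (fun s : ℝ => fderiv ℝ u (x + s • e) e) (secondPartial u x i) 0 := by
    have h1 : HasFDerivAt (fun y => fderiv ℝ u y e) (fderiv ℝ (fun y => fderiv ℝ u y e) x)
        (x + (0 : ℝ) • e) := by
      rw [hx0]; exact (differentiableAt_partial hu e).hasFDerivAt
    exact HasFDerivAt.comp_hasDerivAt (f := fun s : ℝ => x + s • e) (0 : ℝ) h1 (hline 0)
  have hdd : deriv (deriv fun s : ℝ => u (x + s • e)) 0 = secondPartial u x i := by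
    rw [hderiv.deriv_eq, hd2.deriv]
  have hlmax : IsLocalMax (fun s : ℝ => u (x + s • e)) 0 := by
    have := ht.eventually hmax
    simpa [IsLocalMax, IsMaxFilter] using this
  have hlmin : IsLocalMin (fun s : ℝ => u (x + s • e)) 0 := by
    refine isLocalMin_of_deriv_deriv_pos (by rwa [hdd]) hlmax.deriv_eq_zero ?_
    have h1 : ContinuousAt u (x + (0 : ℝ) • e) := by rw [hx0]; exact hu.continuousAt
    exact h1.comp (f := fun s : ℝ => x + s • e) (hline 0).continuousAt
  have hconst : (fun s : ℝ => u (x + s • e)) =ᶠ[𝓝 0] fun _ => u (x + (0 : ℝ) • e) := by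
    filter_upwards [hlmax, hlmin] with s h1 h2 using le_antisymm h1 h2
  have : deriv (deriv fun s : ℝ => u (x + s • e)) 0 = 0 := by
    rw [hconst.deriv.deriv_eq]; simp
  linarith

theorem exists_norm_lt_of_solvesDirichlet {n : ℕ} {ρ μ : ℝ} (hρ : 0 < ρ)
    {f : EuclideanSpace ℝ (Fin n) → ℝ} (hf : SolvesDirichletAtInfinity n ρ μ f) :
    ∃ s, 0 < s ∧ s < ρ ∧ ∀ x : EuclideanSpace ℝ (Fin n), s ≤ ‖x‖ → ‖x‖ < ρ → f x < 1 / 2 := by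
  have h1 := hf.2.2.eventually (gt_mem_nhds (by norm_num : (0 : ℝ) < 1 / 2))
  rw [eventually_inf_principal, eventually_comap] at h1
  obtain ⟨R, hR⟩ := eventually_atTop.1 h1
  have hlim : Tendsto (fun s => ρ * Real.log ((ρ + s) / (ρ - s))) (𝓝[<] ρ) atTop := by
    refine Tendsto.const_mul_atTop hρ (Real.tendsto_log_atTop.comp ?_)
    have hnum : Tendsto (fun s => ρ + s) (𝓝[<] ρ) (𝓝 (ρ + ρ)) :=
      (tendsto_const_nhds.add tendsto_id).mono_left nhdsWithin_le_nhds
    have hden : Tendsto (fun s => ρ - s) (𝓝[<] ρ) (𝓝[>] 0) := by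
      refine tendsto_nhdsWithin_iff.2 ⟨?_, ?_⟩
      · have : Tendsto (fun s : ℝ => ρ - s) (𝓝 ρ) (𝓝 (ρ - ρ)) :=
          tendsto_const_nhds.sub tendsto_id
        simpa using this.mono_left nhdsWithin_le_nhds
      · filter_upwards [self_mem_nhdsWithin] with s hs using sub_pos.2 (Set.mem_Iio.1 hs)
    simpa only [div_eq_mul_inv, Function.comp_apply] using
      hnum.pos_mul_atTop (by linarith) (tendsto_inv_nhdsGT_zero.comp hden)
  obtain ⟨s, hs, hs'⟩ := mem_nhdsLT_iff_exists_Ioo_subset.1 (hlim.eventually_ge_atTop R)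
  have hs : s < ρ := hs
  -- The midpoint lies strictly beyond s, as the open interval requires, and is positive even if s
  -- is not.
  refine ⟨(max s 0 + ρ) / 2, ?_, ?_, fun x hx1 hx2 => ?_⟩
  · linarith [le_max_right s 0]
  · linarith [max_lt hs hρ]
  · refine hR (hypRadius ρ x) (hs' ⟨?_, hx2⟩) x rfl (by simpa using hx2)
    linarith [max_lt hs hρ, le_max_left s 0]

theorem not_solvesDirichletAtInfinity_of_nonpos {m : ℕ} {ρ μ : ℝ} (hρ : 0 < ρ) (hμ : μ ≤ 0)
    {f : EuclideanSpace ℝ (Fin (m + 2)) → ℝ} : ¬ SolvesDirichletAtInfinity (m + 2) ρ μ f := by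
  intro hf
  obtain ⟨s, hs0, hsρ, hs⟩ := exists_norm_lt_of_solvesDirichlet hρ hf
  obtain ⟨⟨hC, hE⟩, hf0, -⟩ := hf
  -- With ερ² = 1/4, the perturbed function f + ε|y|² is 1 at the origin and below 3/4 on the sphere
  -- |y| = s. Its maximum is therefore interior, and f ≥ 3/4 there.
  set ε := 1 / (4 * ρ ^ 2) with hε
  have hεpos : 0 < ε := by positivity
  have hερ : ε * ρ ^ 2 = 1 / 4 := by rw [hε]; field_simp
  have hsub : Metric.closedBall (0 : EuclideanSpace ℝ (Fin (m + 2))) s ⊆ Metric.ball 0 ρ :=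
    Metric.closedBall_subset_ball hsρ
  have hsqC : ContDiff ℝ 2 fun y : EuclideanSpace ℝ (Fin (m + 2)) => ε * ‖y‖ ^ 2 :=
    contDiff_const.mul (contDiff_norm_sq ℝ)
  have huC : ContDiffOn ℝ 2 (fun y => f y + ε * ‖y‖ ^ 2) (Metric.ball 0 ρ) :=
    hC.add hsqC.contDiffOn
  obtain ⟨x, hxs, hxmax⟩ := (isCompact_closedBall (0 : EuclideanSpace ℝ (Fin (m + 2))) s)
    |>.exists_isMaxOn ⟨0, by simpa using hs0.le⟩ (huC.continuousOn.mono hsub)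
  have hx := hsub hxs
  have hxρ := norm_lt_of_mem_ball hx
  have hq := sq_sub_norm_sq_pos hx
  have hux : 1 ≤ f x + ε * ‖x‖ ^ 2 := by
    have := hxmax (by simpa using hs0.le : (0 : EuclideanSpace ℝ (Fin (m + 2))) ∈ _)
    simpa [hf0] using this
  have hεx : ε * ‖x‖ ^ 2 ≤ 1 / 4 := by
    rw [← hερ]
    exact mul_le_mul_of_nonneg_left (by linarith) hεpos.le
  have hxlt : ‖x‖ < s := by
    by_contra! hle
    linarith [hs x hle hxρ]
  have hlmax : IsLocalMax (fun y => f y + ε * ‖y‖ ^ 2) x :=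
    hxmax.isLocalMax (Filter.mem_of_superset
      (Metric.isOpen_ball.mem_nhds (by simpa using hxlt)) Metric.ball_subset_closedBall)
  have hfx : ContDiffAt ℝ 2 f x := hC.contDiffAt (Metric.isOpen_ball.mem_nhds hx)
  have hux2 : ContDiffAt ℝ 2 (fun y => f y + ε * ‖y‖ ^ 2) x :=
    huC.contDiffAt (Metric.isOpen_ball.mem_nhds hx)
  have hpart : ∀ y, DifferentiableAt ℝ f y → ∀ i,
      fderiv ℝ (fun y => f y + ε * ‖y‖ ^ 2) y (EuclideanSpace.single i 1) =
        fderiv ℝ f y (EuclideanSpace.single i 1) + 2 * ε * y i := by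
    intro y hy i
    have h1 : HasFDerivAt (fun y => f y + ε * ‖y‖ ^ 2) _ y :=
      hy.hasFDerivAt.add ((hasFDerivAt_norm_sq' y).const_mul ε)
    rw [h1.fderiv]
    simp [EuclideanSpace.inner_single_right]
    ring
  have hdiff : ∀ᶠ y in 𝓝 x, DifferentiableAt ℝ f y := by
    filter_upwards [hfx.eventually (by simp)] with y hy using hy.differentiableAt (by norm_num)
  have hD1 : ∀ i, fderiv ℝ f x (EuclideanSpace.single i 1) = -(2 * ε * x i) := by
    intro i
    have h1 := hpart x hdiff.self_of_nhds i
    rw [hlmax.fderiv_eq_zero] at h1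
    have h2 : (0 : ℝ) = fderiv ℝ f x (EuclideanSpace.single i 1) + 2 * ε * x i := by simpa using h1
    linarith
  have hD2 : ∀ i, secondPartial f x i ≤ -(2 * ε) := by
    intro i
    have h1 := secondPartial_nonpos_of_isLocalMax hux2 hlmax i
    have h2 : (fun y => fderiv ℝ (fun y => f y + ε * ‖y‖ ^ 2) y (EuclideanSpace.single i 1)) =ᶠ[𝓝 x]
        fun y => fderiv ℝ f y (EuclideanSpace.single i 1) + 2 * ε * y i := by
      filter_upwards [hdiff] with y hy using hpart y hy i
    have hc : HasFDerivAt (fun y : EuclideanSpace ℝ (Fin (m + 2)) => y i)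
      (EuclideanSpace.proj i : EuclideanSpace ℝ (Fin (m + 2)) →L[ℝ] ℝ) x :=
      (EuclideanSpace.proj i : EuclideanSpace ℝ (Fin (m + 2)) →L[ℝ] ℝ).hasFDerivAt
    have h3 : HasFDerivAt (fun y => fderiv ℝ f y (EuclideanSpace.single i 1) + 2 * ε * y i) _ x :=
      (differentiableAt_partial hfx _).hasFDerivAt.add (hc.const_mul (2 * ε))
    rw [secondPartial, h2.fderiv_eq, h3.fderiv] at h1
    have h4 : secondPartial f x i + 2 * ε ≤ 0 := by simpa [secondPartial] using h1
    linarith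
  -- At the maximum ∂_i f = -2εx_i and ∂_i∂_i f ≤ -2ε, so every summand is strictly negative;
  -- without ε the inequality would not be strict.
  have hneg : laplaceBeltrami (ballMetric (m + 2) ρ) f x < 0 := by
    rw [laplaceBeltrami_ballMetric m hρ hx hfx]
    refine mul_neg_of_pos_of_neg (by positivity) (Finset.sum_neg (fun i _ => ?_)
      Finset.univ_nonempty)
    rw [hD1]
    have h1 : 0 ≤ 2 * m * x i / (ρ ^ 2 - ‖x‖ ^ 2) * (2 * ε * x i) := by
      have : 2 * m * x i / (ρ ^ 2 - ‖x‖ ^ 2) * (2 * ε * x i) =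
        4 * m * ε / (ρ ^ 2 - ‖x‖ ^ 2) * x i ^ 2 := by ring
      rw [this]; positivity
    linarith [hD2 i]
  have h5 := hE x hx
  have h6 : μ * f x ≤ 0 := mul_nonpos_of_nonpos_of_nonneg hμ (by linarith)
  linarith

end HypBall

/-! ### Assembly of the two statements -/

theorem mainTheorem7 (k : ℕ) (hk : 1 ≤ k) (ρ : ℝ) (hρ : 0 < ρ) (μ : ℝ) :
    (∃ φ : ℝ → ℝ,
      HypBall.IsNormalizedRadialEigenfunction (k + 1) ρ μ φ ∧
      (∀ ψ : ℝ → ℝ, HypBall.IsNormalizedRadialEigenfunction (k + 1) ρ μ ψ →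
        Set.EqOn ψ φ (Set.Ici 0)) ∧
      (μ < 0 → Tendsto φ atTop atTop) ∧
      (μ = 0 → Tendsto φ atTop (𝓝 1)) ∧
      (0 < μ → Tendsto φ atTop (𝓝 0))) ∧
    ((∃ f : EuclideanSpace ℝ (Fin (k + 1)) → ℝ,
      HypBall.SolvesDirichletAtInfinity (k + 1) ρ μ f) ↔ 0 < μ) := by
  obtain ⟨m, rfl⟩ : ∃ m, k = m + 1 := ⟨k - 1, by omega⟩
  have hν : (1 : ℝ) ≤ ((m : ℝ) + 2) / 2 := by
    have : (0 : ℝ) ≤ m := m.cast_nonneg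
    linarith
  have hφ := HypBall.isNormalizedRadialEigenfunction_radialProfile m hρ μ
  have hlim := HypBall.radialCoord_tendsto hρ
  have hρ2 : 0 < ρ ^ 2 := by positivity
  have hzero : 0 < μ → Tendsto (fun r => HypBall.radialProfile (((m : ℝ) + 2) / 2) (μ * ρ ^ 2)
      (HypBall.radialCoord ρ r)) atTop (𝓝 0) := fun hμ =>
    (HypBall.radialProfile_tendsto_zero hν (mul_pos hμ hρ2)).comp hlim
  refine ⟨⟨_, hφ, fun ψ hψ => hψ.eqOn hρ hφ, fun hμ => ?_, fun hμ => ?_, hzero⟩, ?_, fun hμ => ?_⟩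
  · exact (HypBall.radialProfile_tendsto_atTop hν (mul_neg_of_neg_of_pos hμ hρ2)).comp hlim
  · subst hμ
    simp only [zero_mul, HypBall.radialProfile_eq_one hν]
    exact tendsto_const_nhds
  · rintro ⟨f, hf⟩
    by_contra! hμ
    exact HypBall.not_solvesDirichletAtInfinity_of_nonpos hρ hμ hf
  -- The radial eigenfunction itself solves the Dirichlet problem. Its decay in r pulls back along
  -- `hypRadius`, uniformly in the direction.
  · refine ⟨_, hφ.1, ?_, ((hzero hμ).comp tendsto_comap).mono_left inf_le_left⟩
    simpa only [HypBall.hypRadius_zero hρ] using hφ.2
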